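/- Let $d\ge 0$, let $I_1,\dots,I_d\subset\mathbb R$ be intervals (of any kind, bounded or unbounded), $\mathbf I=I_1\times\dots\times I_d$, and let $\mathbf n=(n_1,\dots,n_d)$ with integers $n_i\ge 0$. For pairwise distinct points, divided differences are defined by $[x_0;g]=g(x_0)$ and $[x_0,\dots,x_{n+1};g]=\frac{[x_1,\dots,x_{n+1};g]-[x_0,\dots,x_n;g]}{x_{n+1}-x_0}$. A function $g\colon I\to\mathbb R$ on an interval is called $(n-1)$-convex ($n\ge0$) if $[x_0,\dots,x_n;g]\ge 0$ for all pairwise distinct $x_0,\dots,x_n\in I$ (so $(-1)$-convex means nonnegative, $0$-convex means nondecreasing, $1$-convex means convex). For $I$-valued random variables $X,Y$ (equivalently, for their laws), $X\le_{(n-1)\text{-cx}}Y$ means that $\mathbb E\,g(X)\le\mathbb E\,g(Y)$ for every $(n-1)$-convex $g\colon I\to\mathbb R$ for which both expectations exist (as finite numbers). A function $f\colon\mathbf I\to\mathbb R$ is box-$\mathbf n$-convex if its multiple divided difference, obtained by applying the divided difference at pairwise distinct points $x_{i0},\dots,x_{in_i}\in I_i$ in the $i$-th argument of $f$ successively for $i=1,\dots,d$,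 is nonnegative for all choices of such points. For $i=1,\dots,d$ let $X_i,Y_i$ be $I_i$-valued random variables such that $X_i\le_{(n_i-1)\text{-cx}}Y_i$ and, if $n_i\ge1$, $\mathbb E|X_i|^{n_i-1}<\infty$ and $\mathbb E|Y_i|^{n_i-1}<\infty$. Let $\nu_i$ and $\mu_i$ be the laws of $X_i$ and $Y_i$, respectively. For each $A\subset\{1,\dots,d\}$ let $Z_{1,A},\dots,Z_{d,A}$ be independent random variables such that $Z_{i,A}$ has the law of $X_i$ if $i\in A$ and the law of $Y_i$ if $i\notin A$. Then for every continuous box-$\mathbf n$-convex function $f\colon\mathbf I\to\mathbb R$: 1. if the expectations $\mathbb E f(Z_{1,A},\dots,Z_{d,A})$ exist (as finite numbers) for all $A\subset\{1,\dots,d\}$, then $$\sum_{A\subset\{1,\dots,d\}}(-1)^{|A|}\,\mathbb E f(Z_{1,A},\dots,Z_{d,A})\ge 0;$$ 2. if $f$ is integrable with respect to the total variation of the product signed measure $(\mu_1-\nu_1)\otimes\dots\otimes(\mu_d-\nu_d)$, then $$\int\!\cdots\!\int_{\mathbf I} f(x_1,\dots,x_d)\,d(\mu_1-\nu_1)(x_1)\cdots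 d(\mu_d-\nu_d)(x_d)\ge 0 .$$ -/

import Mathlib

open MeasureTheory ProbabilityTheory

noncomputable section

/-- The divided difference `[x₀, x₁, …, xₙ; f]` of order `n`:
`[x₀; f] = f x₀` and
`[x₀, …, xₙ₊₁; f] = ([x₁, …, xₙ₊₁; f] - [x₀, …, xₙ; f]) / (xₙ₊₁ - x₀)`. -/
def dividedDiff : (n : ℕ) → (Fin (n + 1) → ℝ) → (ℝ → ℝ) → ℝ
  | 0, x, f => f (x 0)
  | n + 1, x, f =>
      (dividedDiff n (fun j => x j.succ) f - dividedDiff n (fun j => x j.castSucc) f) /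
        (x (Fin.last (n + 1)) - x 0)

/-- The multiple divided difference of order `(n₁, …, n_d)` of a function of `d` variables:
the one-variable divided differences are applied to the successive arguments of `f`.  For `d = 0`
it is the value of the constant `f`. -/
def multiDividedDiff : (d : ℕ) → (n : Fin d → ℕ) → ((i : Fin d) → Fin (n i + 1) → ℝ) →
    ((Fin d → ℝ) → ℝ) → ℝ
  | 0, _, _, f => f Fin.elim0
  | d + 1, n, x, f =>
      dividedDiff (n (Fin.last d)) (x (Fin.last d)) fun t =>
        multiDividedDiff d (fun i => n i.castSucc) (fun i => x i.castSucc) fun y =>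
          f (Fin.snoc (α := fun _ => ℝ) y t)

/-- `f` is box-`(n₁, …, n_d)`-convex on `I₁ × ⋯ × I_d`.  Only the values of `f` on the box
matter. -/
def BoxConvexOn {d : ℕ} (n : Fin d → ℕ) (I : Fin d → Set ℝ) (f : (Fin d → ℝ) → ℝ) : Prop :=
  ∀ x : (i : Fin d) → Fin (n i + 1) → ℝ,
    (∀ i, Function.Injective (x i)) → (∀ i j, x i j ∈ I i) → 0 ≤ multiDividedDiff d n x f

/-- All divided differences of order `n` of `f` at pairwise distinct points of `I` are
nonnegative.  In the classical indexing, this says that `f` is `(n - 1)`-convex on `I`: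
nonnegative for `n = 0`, nondecreasing for `n = 1`, convex for `n = 2`. -/
def PredConvexOn (n : ℕ) (I : Set ℝ) (f : ℝ → ℝ) : Prop :=
  ∀ x : Fin (n + 1) → ℝ, Function.Injective x → (∀ j, x j ∈ I) → 0 ≤ dividedDiff n x f

/-- The `(n - 1)`-convex order between two laws on the interval `I`: the expectation under `μ` is
at most the expectation under `ν` for every `(n - 1)`-convex function on `I` for which both
expectations exist. -/
def PredConvexOrder (n : ℕ) (I : Set ℝ) (μ ν : Measure ℝ) : Prop :=
  ∀ g : ℝ → ℝ, PredConvexOn n I g → Integrable g μ → Integrable g ν →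
    ∫ t, g t ∂μ ≤ ∫ t, g t ∂ν

/-- The family of measures equal to `ν i` for `i ∈ A` and to `μ i` for `i ∉ A`. -/
def mixMeasure {d : ℕ} (A : Finset (Fin d)) (μ ν : Fin d → Measure ℝ) (i : Fin d) : Measure ℝ :=
  if i ∈ A then ν i else μ i

instance mixMeasure.instIsFiniteMeasure {d : ℕ} (A : Finset (Fin d)) (μ ν : Fin d → Measure ℝ)
    [∀ i, IsFiniteMeasure (μ i)] [∀ i, IsFiniteMeasure (ν i)] (i : Fin d) :
    IsFiniteMeasure (mixMeasure A μ ν i) := by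
  unfold mixMeasure
  split_ifs <;> infer_instance

/-- The product signed measure `(μ₁ - ν₁) ⊗ ⋯ ⊗ (μ_d - ν_d)` on `ℝ^d`, obtained by
multilinearity.  It is characterised by its values on measurable boxes, see
`prodSignedDiff_pi`. -/
def prodSignedDiff {d : ℕ} (μ ν : Fin d → Measure ℝ)
    [∀ i, IsFiniteMeasure (μ i)] [∀ i, IsFiniteMeasure (ν i)] : SignedMeasure (Fin d → ℝ) :=
  ∑ A : Finset (Fin d), (-1 : ℝ) ^ A.card • (Measure.pi (mixMeasure A μ ν)).toSignedMeasure

theorem prodSignedDiff_pi {d : ℕ} (μ ν : Fin d → Measure ℝ)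
    [∀ i, IsFiniteMeasure (μ i)] [∀ i, IsFiniteMeasure (ν i)]
    (s : Fin d → Set ℝ) (hs : ∀ i, MeasurableSet (s i)) :
    prodSignedDiff μ ν (Set.univ.pi s) = ∏ i, ((μ i).real (s i) - (ν i).real (s i)) := by
  have hm : MeasurableSet (Set.univ.pi s) := MeasurableSet.univ_pi hs
  have hA : ∀ A : Finset (Fin d),
      (Measure.pi (mixMeasure A μ ν)).toSignedMeasure (Set.univ.pi s) =
        ∏ i, if i ∈ A then (ν i).real (s i) else (μ i).real (s i) := by
    intro A
    rw [Measure.toSignedMeasure_apply_measurable hm, Measure.real, Measure.pi_pi,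
      ENNReal.toReal_prod]
    refine Finset.prod_congr rfl fun i _ => ?_
    unfold mixMeasure
    split_ifs <;> rfl
  have h1 : prodSignedDiff μ ν (Set.univ.pi s) =
      ∑ A : Finset (Fin d), (-1 : ℝ) ^ A.card *
        ∏ i, if i ∈ A then (ν i).real (s i) else (μ i).real (s i) := by
    unfold prodSignedDiff
    rw [FunLike.coe_sum, Finset.sum_apply]
    refine Finset.sum_congr rfl fun A _ => ?_
    rw [smul_apply, hA, smul_eq_mul]
  have h2 : ∏ i, ((μ i).real (s i) - (ν i).real (s i)) =
      ∏ i, (-(ν i).real (s i) + (μ i).real (s i)) :=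
    Finset.prod_congr rfl fun i _ => by ring
  rw [h1, h2, Finset.prod_add, Finset.powerset_univ]
  refine Finset.sum_congr rfl fun A _ => ?_
  rw [Finset.prod_neg, Finset.prod_ite, mul_assoc]
  congr 2
  · simp
  · exact Finset.prod_congr (by ext; simp) fun _ _ => rfl

end

/-! Below, "n-convex" means that divided differences of order n are nonnegative. Write μ_i - ν_i =
s_i τ_i with τ_i the total variation and |s_i| = 1. The product signed measure then has total
variation ⊗τ_i and density ∏ s_i(x_i), so the second claim reads 0 ≤ ∫ f ∏ s_i(x_i) d⊗τ_i. The
alternating sum in the first claim is the same integral, expanded by multilinearity.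

One variable. The order tests only functions integrable under both laws, while the proof needs 0 ≤ ∫
F s dτ for F integrable under τ alone and n-convex only on some interval J carrying τ. Such an F is
approximated in L¹(τ) by n-convex functions on the line that are polynomials of degree < n outside a
bounded interval; the moment hypothesis makes these integrable under both laws
(`exists_global_approximation`, `exists_signedConvexOrder`). The case n = 0, and the case where τ
lives on at most n points, force τ = 0.

Several variables. Induct on d and integrate out all coordinates but the last: F(t) = ∫ f(y, t) ∏
s_i(y_i) dτ'(y). The induction hypothesis, applied to divided differences of f in t, makes F
n-convex at those t whose section f(·, t) is integrable, but a priori these t need not form an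
interval. This is cured by normalization (`exists_normalization`): s_i τ_i annihilates polynomials
of degree < n_i, so subtracting from f its interpolation at n_i nodes in each coordinate changes
neither the integral nor box-convexity. The new f vanishes whenever some x_i is a node; hence for
almost every y either f(y, ·) vanishes or a sign depending on y makes it n-convex. An n-convex
function lies between two of its interpolation polynomials, so a section lying between integrable
ones is dominated by finitely many integrable sections (`integrable_section_of_between`). -/

open MeasureTheory ProbabilityTheory

section

open Polynomial Finset Filter Topology

noncomputable section

/-! ### Divided differences over finite sets of nodes -/

/-- The divided difference of `f` at the points of a finite set. -/
def divDiff (X : Finset ℝ) (f : ℝ → ℝ) : ℝ :=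
  ∑ x ∈ X, f x / ∏ y ∈ X.erase x, (x - y)

theorem divDiff_congr {X : Finset ℝ} {f g : ℝ → ℝ} (h : ∀ x ∈ X, f x = g x) :
    divDiff X f = divDiff X g :=
  Finset.sum_congr rfl fun x hx => by rw [h x hx]

theorem divDiff_add (X : Finset ℝ) (f g : ℝ → ℝ) :
    divDiff X (fun x => f x + g x) = divDiff X f + divDiff X g := by
  simp [divDiff, add_div, Finset.sum_add_distrib]

theorem divDiff_sub (X : Finset ℝ) (f g : ℝ → ℝ) :
    divDiff X (fun x => f x - g x) = divDiff X f - divDiff X g := by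
  simp [divDiff, sub_div, Finset.sum_sub_distrib]

theorem divDiff_const_mul (X : Finset ℝ) (c : ℝ) (f : ℝ → ℝ) :
    divDiff X (fun x => c * f x) = c * divDiff X f := by
  simp [divDiff, mul_div_assoc, Finset.mul_sum]

theorem divDiff_mul_const (X : Finset ℝ) (c : ℝ) (f : ℝ → ℝ) :
    divDiff X (fun x => f x * c) = divDiff X f * c := by
  simp_rw [mul_comm _ c]
  exact divDiff_const_mul X c f

theorem divDiff_singleton (x : ℝ) (f : ℝ → ℝ) : divDiff {x} f = f x := by
  simp [divDiff]

/-- The recursion for divided differences. -/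
theorem sub_mul_divDiff_insert_insert {R : Finset ℝ} {a b : ℝ} (hab : a ≠ b) (ha : a ∉ R)
    (hb : b ∉ R) (f : ℝ → ℝ) :
    (b - a) * divDiff (insert a (insert b R)) f =
      divDiff (insert b R) f - divDiff (insert a R) f := by
  have hab' : b - a ≠ 0 := sub_ne_zero.2 hab.symm
  have ha' : a ∉ insert b R := by simp [hab, ha]
  unfold divDiff
  rw [Finset.sum_insert ha', Finset.sum_insert hb, Finset.sum_insert hb, Finset.sum_insert ha]
  have e1 : (insert a (insert b R)).erase a = insert b R := Finset.erase_insert ha'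
  have e2 : (insert a (insert b R)).erase b = insert a R := by
    rw [Finset.insert_comm, Finset.erase_insert]
    simp [hab.symm, hb]
  rw [e1, e2, Finset.erase_insert hb, Finset.erase_insert ha, Finset.prod_insert hb,
    Finset.prod_insert ha]
  have hR : ∀ x ∈ R, (f x / ∏ y ∈ (insert a (insert b R)).erase x, (x - y)) * (b - a) =
      f x / ∏ y ∈ (insert b R).erase x, (x - y) - f x / ∏ y ∈ (insert a R).erase x, (x - y) := by
    intro x hx
    have hxa : x ≠ a := fun h => ha (h ▸ hx)
    have hxb : x ≠ b := fun h => hb (h ▸ hx)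
    have hax : a ∉ R.erase x := fun h => ha (Finset.mem_of_mem_erase h)
    have hbx : b ∉ R.erase x := fun h => hb (Finset.mem_of_mem_erase h)
    rw [Finset.erase_insert_of_ne hxa.symm, Finset.erase_insert_of_ne hxb.symm,
      Finset.erase_insert_of_ne hxa.symm, Finset.prod_insert (by simp [hab, hax]),
      Finset.prod_insert hbx, Finset.prod_insert hax]
    have h1 : x - a ≠ 0 := sub_ne_zero.2 hxa
    have h2 : x - b ≠ 0 := sub_ne_zero.2 hxb
    have h3 : ∏ y ∈ R.erase x, (x - y) ≠ 0 :=
      Finset.prod_ne_zero_iff.2 fun y hy => sub_ne_zero.2 (Finset.ne_of_mem_erase hy).symm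
    field_simp
    ring
  have hs : (b - a) * ∑ x ∈ R, f x / ∏ y ∈ (insert a (insert b R)).erase x, (x - y) =
      ∑ x ∈ R, f x / ∏ y ∈ (insert b R).erase x, (x - y) -
        ∑ x ∈ R, f x / ∏ y ∈ (insert a R).erase x, (x - y) := by
    rw [Finset.mul_sum, ← Finset.sum_sub_distrib]
    exact Finset.sum_congr rfl fun x hx => by rw [← hR x hx, mul_comm]
  have h3 : ∏ y ∈ R, (a - y) ≠ 0 :=
    Finset.prod_ne_zero_iff.2 fun y hy => sub_ne_zero.2 fun h => ha (h ▸ hy)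
  have h4 : ∏ y ∈ R, (b - y) ≠ 0 :=
    Finset.prod_ne_zero_iff.2 fun y hy => sub_ne_zero.2 fun h => hb (h ▸ hy)
  have h5 : a - b ≠ 0 := sub_ne_zero.2 hab
  rw [mul_add, mul_add, hs]
  have e3 : (b - a) * (f a / ((a - b) * ∏ y ∈ R, (a - y))) = -(f a / ∏ y ∈ R, (a - y)) := by
    field_simp
    ring
  have e4 : (b - a) * (f b / ((b - a) * ∏ y ∈ R, (b - y))) = f b / ∏ y ∈ R, (b - y) := by
    field_simp
  rw [e3, e4]
  ring

/-- Insertion of a point between two others. -/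
theorem sub_mul_divDiff_three {R : Finset ℝ} {a b y : ℝ} (hab : a ≠ b) (hay : a ≠ y)
    (hby : b ≠ y) (ha : a ∉ R) (hb : b ∉ R) (hy : y ∉ R) (f : ℝ → ℝ) :
    (b - a) * divDiff (insert a (insert b R)) f =
      (y - a) * divDiff (insert a (insert y R)) f +
        (b - y) * divDiff (insert y (insert b R)) f := by
  rw [sub_mul_divDiff_insert_insert hab ha hb, sub_mul_divDiff_insert_insert hay ha hy,
    sub_mul_divDiff_insert_insert hby.symm hy hb]
  ring

theorem divDiff_insert_of_eq_zero {A : Finset ℝ} {x : ℝ} (hx : x ∉ A) {f : ℝ → ℝ}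
    (hf : ∀ a ∈ A, f a = 0) : divDiff (insert x A) f = f x / ∏ a ∈ A, (x - a) := by
  unfold divDiff
  rw [Finset.sum_insert hx, Finset.erase_insert hx, Finset.sum_eq_zero, add_zero]
  intro a ha
  rw [hf a ha, zero_div]

/-- The factor x - a kills the term at a and cancels the same factor in every other denominator. -/
theorem divDiff_sub_mul {R : Finset ℝ} {a : ℝ} (ha : a ∉ R) (f : ℝ → ℝ) :
    divDiff (insert a R) (fun x => (x - a) * f x) = divDiff R f := by
  unfold divDiff
  rw [Finset.sum_insert ha]
  simp only [sub_self, zero_mul, zero_div, zero_add]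
  refine Finset.sum_congr rfl fun x hx => ?_
  have hxa : x ≠ a := fun h => ha (h ▸ hx)
  rw [Finset.erase_insert_of_ne hxa.symm,
    Finset.prod_insert fun h => ha (Finset.mem_of_mem_erase h),
    mul_div_mul_left _ _ (sub_ne_zero.2 hxa)]

/-- By Lagrange interpolation the divided difference at n + 1 nodes is the coefficient of degree n.
-/
theorem divDiff_eval_eq_zero {X : Finset ℝ} {n : ℕ} (hX : #X = n + 1) {P : ℝ[X]}
    (hP : P.degree < n) : divDiff X (fun x => P.eval x) = 0 := by
  have h1 : P.degree < #X := hP.trans (by rw [hX]; exact_mod_cast Nat.lt_succ_self n)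
  have h2 := Lagrange.coeff_eq_sum (s := X) (v := id) Function.injective_id.injOn h1
  simp only [id] at h2
  rw [divDiff, ← h2, hX, Nat.add_sub_cancel]
  exact Polynomial.coeff_eq_zero_of_degree_lt hP

/-- `dividedDiff` at pairwise distinct points in terms of `divDiff`. -/
theorem dividedDiff_eq_divDiff (n : ℕ) (x : Fin (n + 1) → ℝ) (hx : Function.Injective x)
    (f : ℝ → ℝ) : dividedDiff n x f = divDiff (univ.image x) f := by
  induction n with
  | zero => simp [dividedDiff, divDiff_singleton]
  | succ n ih =>
    rw [dividedDiff, ih (fun j => x j.succ) (hx.comp (Fin.succ_injective _)),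
      ih (fun j => x j.castSucc) (hx.comp (Fin.castSucc_injective _))]
    set R : Finset ℝ := univ.image fun j : Fin n => x j.succ.castSucc with hR
    have hab : x 0 ≠ x (Fin.last (n + 1)) := hx.ne (Fin.last_pos).ne
    have ha : x 0 ∉ R := by
      simp only [hR, Finset.mem_image, Finset.mem_univ, true_and, not_exists]
      intro j h
      have := hx h
      simp [Fin.ext_iff] at this
    have hb : x (Fin.last (n + 1)) ∉ R := by
      simp only [hR, Finset.mem_image, Finset.mem_univ, true_and, not_exists]
      intro j h
      have := hx h
      simp [Fin.ext_iff] at this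
      omega
    have e1 : (univ.image fun j : Fin (n + 1) => x j.succ) = insert (x (Fin.last (n + 1))) R := by
      rw [Fin.univ_castSuccEmb, Finset.cons_eq_insert, Finset.image_insert, Finset.map_eq_image,
        Finset.image_image]
      rfl
    have e2 : (univ.image fun j : Fin (n + 1) => x j.castSucc) = insert (x 0) R := by
      rw [Fin.univ_succ, Finset.cons_eq_insert, Finset.image_insert, Finset.map_eq_image,
        Finset.image_image]
      rfl
    have e3 : univ.image x = insert (x 0) (insert (x (Fin.last (n + 1))) R) := by
      rw [← e1, Fin.univ_succ, Finset.cons_eq_insert, Finset.image_insert, Finset.map_eq_image,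
        Finset.image_image]
      rfl
    rw [e1, e2, e3, ← sub_mul_divDiff_insert_insert hab ha hb,
      mul_div_cancel_left₀ _ (sub_ne_zero.2 hab.symm)]

/-! ### n-convex functions on arbitrary sets, and their interpolation polynomials -/

/-- All divided differences of order `n` at points of `D` are nonnegative. -/
def NConvexOn (n : ℕ) (D : Set ℝ) (f : ℝ → ℝ) : Prop :=
  ∀ X : Finset ℝ, ↑X ⊆ D → #X = n + 1 → 0 ≤ divDiff X f

theorem exists_injective_image_eq {n : ℕ} {X : Finset ℝ} (hX : #X = n + 1) :
    ∃ x : Fin (n + 1) → ℝ, Function.Injective x ∧ univ.image x = X := by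
  refine ⟨fun j => X.equivFin.symm (Fin.cast hX.symm j), ?_, ?_⟩
  · exact Subtype.val_injective.comp (X.equivFin.symm.injective.comp (Fin.cast_injective _))
  · ext a
    simp only [Finset.mem_image, Finset.mem_univ, true_and]
    constructor
    · rintro ⟨j, rfl⟩
      exact Subtype.property _
    · intro ha
      exact ⟨Fin.cast hX (X.equivFin ⟨a, ha⟩), by simp⟩

theorem predConvexOn_iff_nConvexOn {n : ℕ} {D : Set ℝ} {f : ℝ → ℝ} :
    PredConvexOn n D f ↔ NConvexOn n D f := by
  constructor
  · intro h X hXD hX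
    obtain ⟨x, hx, rfl⟩ := exists_injective_image_eq hX
    rw [← dividedDiff_eq_divDiff n x hx]
    exact h x hx fun j => hXD (by simp)
  · intro h x hx hxD
    rw [dividedDiff_eq_divDiff n x hx]
    refine h _ ?_ ?_
    · intro y hy
      simp only [Finset.coe_image, Finset.coe_univ, Set.image_univ, Set.mem_range] at hy
      obtain ⟨j, rfl⟩ := hy
      exact hxD j
    · rw [Finset.card_image_of_injective _ hx]
      simp

theorem NConvexOn.mono {n : ℕ} {D E : Set ℝ} {f : ℝ → ℝ} (h : NConvexOn n E f) (hDE : D ⊆ E) :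
    NConvexOn n D f := fun X hX hc => h X (hX.trans hDE) hc

theorem NConvexOn.congr {n : ℕ} {D : Set ℝ} {f g : ℝ → ℝ} (h : NConvexOn n D f)
    (hfg : ∀ x ∈ D, f x = g x) : NConvexOn n D g := fun X hX hc => by
  rw [← divDiff_congr fun x hx => hfg x (hX hx)]
  exact h X hX hc

theorem NConvexOn.add {n : ℕ} {D : Set ℝ} {f g : ℝ → ℝ} (hf : NConvexOn n D f)
    (hg : NConvexOn n D g) : NConvexOn n D fun x => f x + g x := fun X hX hc => by
  rw [divDiff_add]
  exact add_nonneg (hf X hX hc) (hg X hX hc)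

theorem NConvexOn.const_mul {n : ℕ} {D : Set ℝ} {f : ℝ → ℝ} (hf : NConvexOn n D f) {c : ℝ}
    (hc : 0 ≤ c) : NConvexOn n D fun x => c * f x := fun X hX hX' => by
  rw [divDiff_const_mul]
  exact mul_nonneg hc (hf X hX hX')

theorem nConvexOn_eval {n : ℕ} {P : ℝ[X]} (hP : P.degree < n) (D : Set ℝ) :
    NConvexOn n D fun x => P.eval x := fun _ _ hX => (divDiff_eval_eq_zero hX hP).ge

/-- The polynomial of degree less than `#A` interpolating `f` at the points of `A`. -/
def interp (A : Finset ℝ) (f : ℝ → ℝ) : ℝ[X] := Lagrange.interpolate A id f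

theorem interp_congr {A : Finset ℝ} {f g : ℝ → ℝ} (h : ∀ a ∈ A, f a = g a) :
    interp A f = interp A g :=
  Lagrange.interpolate_eq_of_values_eq_on _ _ h

theorem degree_interp_lt (A : Finset ℝ) (f : ℝ → ℝ) : (interp A f).degree < #A :=
  Lagrange.degree_interpolate_lt _ Function.injective_id.injOn

theorem eval_interp_of_mem {A : Finset ℝ} {a : ℝ} (ha : a ∈ A) (f : ℝ → ℝ) :
    (interp A f).eval a = f a :=
  Lagrange.eval_interpolate_at_node f Function.injective_id.injOn ha

theorem interp_eval {A : Finset ℝ} {P : ℝ[X]} (hP : P.degree < #A) :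
    interp A (fun x => P.eval x) = P :=
  (Lagrange.eq_interpolate (v := id) Function.injective_id.injOn hP).symm

theorem eval_interp_eq_sum (A : Finset ℝ) (f : ℝ → ℝ) (x : ℝ) :
    (interp A f).eval x = ∑ a ∈ A, (Lagrange.basis A id a).eval x * f a := by
  simp [interp, Lagrange.interpolate_apply, Polynomial.eval_finsetSum, mul_comm]

/-- Newton's remainder: subtracting the interpolant does not change the divided difference and
leaves a function that vanishes on A, so only the term at x survives. -/
theorem sub_eval_interp {A : Finset ℝ} {x : ℝ} (hx : x ∉ A) (f : ℝ → ℝ) :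
    f x - (interp A f).eval x = (∏ a ∈ A, (x - a)) * divDiff (insert x A) f := by
  have h1 : divDiff (insert x A) (fun y => (interp A f).eval y) = 0 :=
    divDiff_eval_eq_zero (Finset.card_insert_of_notMem hx) (degree_interp_lt A f)
  have h2 : divDiff (insert x A) (fun y => f y - (interp A f).eval y) =
      divDiff (insert x A) f := by rw [divDiff_sub, h1, sub_zero]
  rw [← h2, divDiff_insert_of_eq_zero hx fun a ha => by rw [eval_interp_of_mem ha, sub_self],
    mul_div_cancel₀]
  exact Finset.prod_ne_zero_iff.2 fun a ha => sub_ne_zero.2 fun h => hx (h ▸ ha)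

theorem eval_interp_insert_sub {R : Finset ℝ} {a c : ℝ} (ha : a ∉ R) (hc : c ∉ R) (hac : c ≠ a)
    (f : ℝ → ℝ) : (interp (insert a R) f).eval c - (interp R f).eval c =
      (∏ r ∈ R, (c - r)) * divDiff (insert a R) f := by
  have h1 := sub_eval_interp hc f
  have h2 := sub_eval_interp (A := insert a R) (x := c) (by simp [hac, hc]) f
  have h3 := sub_mul_divDiff_insert_insert hac hc ha f
  rw [Finset.prod_insert ha] at h2
  linear_combination h1 - h2 + (∏ r ∈ R, (c - r)) * h3

theorem NConvexOn.eval_interp_le_of_forall_lt {n : ℕ} {D : Set ℝ} {f : ℝ → ℝ}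
    (hf : NConvexOn n D f) {A : Finset ℝ} (hA : #A = n) (hAD : ↑A ⊆ D) {x : ℝ} (hx : x ∈ D)
    (hAx : ∀ a ∈ A, a < x) : (interp A f).eval x ≤ f x := by
  have hxA : x ∉ A := fun h => lt_irrefl _ (hAx x h)
  rw [← sub_nonneg, sub_eval_interp hxA]
  refine mul_nonneg (Finset.prod_nonneg fun a ha => (sub_pos.2 (hAx a ha)).le) (hf _ ?_ ?_)
  · rw [Finset.coe_insert]
    exact Set.insert_subset hx hAD
  · rw [Finset.card_insert_of_notMem hxA, hA]

/-- An `n`-convex function lies between two of its interpolation polynomials. -/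
theorem NConvexOn.interp_sandwich {n : ℕ} {D : Set ℝ} {f : ℝ → ℝ} (hf : NConvexOn n D f)
    {U : Finset ℝ} (hU : #U = n + 1) (hUD : ↑U ⊆ D) {a b x : ℝ} (ha : a ∈ U) (hb : b ∈ U)
    (hax : a < x) (hxb : x < b) (hx : x ∈ D) :
    0 ≤ (f x - (interp (U.erase a) f).eval x) * ((interp (U.erase b) f).eval x - f x) := by
  by_cases hxU : x ∈ U
  · rw [eval_interp_of_mem (Finset.mem_erase.2 ⟨hax.ne', hxU⟩)]
    simp
  have key : ∀ c ∈ U, ∃ r, 0 ≤ r ∧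
      f x - (interp (U.erase c) f).eval x = (∏ u ∈ U.erase c, (x - u)) * r := by
    intro c hc
    have hxc : x ∉ U.erase c := fun h => hxU (Finset.mem_of_mem_erase h)
    refine ⟨_, hf (insert x (U.erase c)) ?_ ?_, sub_eval_interp hxc f⟩
    · rw [Finset.coe_insert]
      exact Set.insert_subset hx ((Finset.coe_subset.2 (Finset.erase_subset _ _)).trans hUD)
    · rw [Finset.card_insert_of_notMem hxc, Finset.card_erase_of_mem hc, hU]
      rfl
  obtain ⟨r, hr, hra⟩ := key a ha
  obtain ⟨q, hq, hqb⟩ := key b hb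
  have ha' := Finset.mul_prod_erase U (fun u => x - u) ha
  have hb' := Finset.mul_prod_erase U (fun u => x - u) hb
  set pa := ∏ u ∈ U.erase a, (x - u)
  set pb := ∏ u ∈ U.erase b, (x - u)
  -- Both (x - a) pa and (x - b) pb equal the product over U, while x - a > 0 > x - b; so pa and pb
  -- have opposite signs.
  have hp : 0 ≤ pa * -pb := by
    have h1 : (x - a) * (b - x) * (pa * -pb) = (∏ u ∈ U, (x - u)) ^ 2 := by
      rw [sq]
      nth_rewrite 1 [← ha']
      rw [← hb']
      ring
    have h2 : 0 < (x - a) * (b - x) := mul_pos (sub_pos.2 hax) (sub_pos.2 hxb)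
    refine nonneg_of_mul_nonneg_right (a := (x - a) * (b - x)) ?_ h2
    rw [h1]
    positivity
  have : (f x - (interp (U.erase a) f).eval x) * ((interp (U.erase b) f).eval x - f x) =
      pa * -pb * (r * q) := by
    rw [hra, ← neg_sub, hqb]
    ring
  rw [this]
  exact mul_nonneg hp (mul_nonneg hr hq)

theorem abs_sub_le_of_between {u v w z : ℝ} (h : 0 ≤ (w - u) * (v - w)) :
    |w - z| ≤ |u - z| + |v - z| := by
  rcases mul_nonneg_iff.1 h with ⟨h1, h2⟩ | ⟨h1, h2⟩
  · rw [abs_le]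
    constructor <;>
      linarith [neg_abs_le (u - z), le_abs_self (v - z), abs_nonneg (u - z), abs_nonneg (v - z)]
  · rw [abs_le]
    constructor <;>
      linarith [neg_abs_le (v - z), le_abs_self (u - z), abs_nonneg (u - z), abs_nonneg (v - z)]

/-- Each of the n differences in a denominator changes sign under reflection. -/
theorem divDiff_image_neg (X : Finset ℝ) {n : ℕ} (hX : #X = n + 1) (f : ℝ → ℝ) :
    divDiff (X.image fun x => -x) f = (-1) ^ n * divDiff X fun x => f (-x) := by
  unfold divDiff
  rw [Finset.sum_image neg_injective.injOn, Finset.mul_sum]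
  refine Finset.sum_congr rfl fun x hx => ?_
  have e : (X.image fun x => -x).erase (-x) = (X.erase x).image fun x => -x :=
    (Finset.image_erase neg_injective X x).symm
  have h2 : ∏ y ∈ X.erase x, (-x - -y) = (-1) ^ n * ∏ y ∈ X.erase x, (x - y) := by
    have hc : #(X.erase x) = n := by rw [Finset.card_erase_of_mem hx, hX]; rfl
    rw [← hc, ← Finset.prod_const, ← Finset.prod_mul_distrib]
    exact Finset.prod_congr rfl fun y _ => by ring
  rw [e, Finset.prod_image neg_injective.injOn, h2, div_mul_eq_div_div_swap,
    div_eq_mul_inv _ ((-1 : ℝ) ^ n), ← inv_pow, mul_comm]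
  norm_num

theorem NConvexOn.reflect {n : ℕ} {D : Set ℝ} {f : ℝ → ℝ} (hf : NConvexOn n D f) :
    NConvexOn n (-D) fun x => (-1) ^ n * f (-x) := by
  intro X hXD hX
  rw [divDiff_const_mul, ← divDiff_image_neg X hX]
  refine hf _ ?_ ?_
  · intro y hy
    simp only [Finset.coe_image, Set.mem_image, Finset.mem_coe] at hy
    obtain ⟨x, hx, rfl⟩ := hy
    exact hXD hx
  · rw [Finset.card_image_of_injective _ neg_injective, hX]

/-! ### Truncation: polynomial continuation of n-convex functions -/

/-- Gluing an `n`-convex function to one of its interpolation polynomials. -/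
theorem divDiff_glue_nonneg {n : ℕ} {D : Set ℝ} {F : ℝ → ℝ} (hF : NConvexOn n D F) {β : ℝ}
    {A : Finset ℝ} (hA : #A = n) (hAβ : ∀ a ∈ A, a < β) (X : Finset ℝ)
    (hX : #X = n + 1) (hXD : ∀ x ∈ X, x < β → x ∈ D) (hAD : ∀ a ∈ A, a ∈ D)
    (hXA : ∀ x ∈ X, x < β → x ∈ A ∨ ∀ a ∈ A, x < a) :
    0 ≤ divDiff X fun x => if x < β then F x else (interp A F).eval x := by
  -- Induction on the number of nodes missing from X. If X has a point b ≥ β and a point a < β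
  -- outside A, then some y ∈ A \ X lies between them, and the three-point identity replaces b or a
  -- by y with positive weights.
  induction h : #(A \ X) using Nat.strong_induction_on generalizing X with
  | _ m ih =>
  by_cases h1 : ∀ x ∈ X, x < β
  · rw [divDiff_congr (g := F) fun x hx => by rw [if_pos (h1 x hx)]]
    exact hF X (fun x hx => hXD x hx (h1 x hx)) hX
  by_cases h2 : ∀ x ∈ X, x < β → x ∈ A
  · rw [divDiff_congr (g := fun x => (interp A F).eval x) fun x hx => ?_]
    · exact (divDiff_eval_eq_zero hX (hA ▸ degree_interp_lt A F)).ge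
    · by_cases hxβ : x < β
      · rw [if_pos hxβ, eval_interp_of_mem (h2 x hx hxβ)]
      · rw [if_neg hxβ]
  push Not at h1 h2
  obtain ⟨b, hbX, hβb⟩ := h1
  obtain ⟨a, haX, haβ, haA⟩ := h2
  have haA' : ∀ y ∈ A, a < y := (hXA a haX haβ).resolve_left haA
  have hbA : b ∉ A := fun hb => (hAβ b hb).not_ge hβb
  have hab : a < b := haβ.trans_le hβb
  -- Otherwise X would contain A, a and b, which are n + 2 points.
  obtain ⟨y, hyA, hyX⟩ : ∃ y ∈ A, y ∉ X := by
    by_contra! hc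
    have h3 : insert a (insert b A) ⊆ X :=
      Finset.insert_subset haX (Finset.insert_subset hbX hc)
    have h4 := Finset.card_le_card h3
    rw [Finset.card_insert_of_notMem (by simp [hab.ne, haA]),
      Finset.card_insert_of_notMem hbA, hA, hX] at h4
    omega
  have hay : a < y := haA' y hyA
  have hyb : y < b := (hAβ y hyA).trans_le hβb
  set R := (X.erase a).erase b with hR
  have haR : a ∉ R := fun h => Finset.notMem_erase a X (Finset.mem_of_mem_erase h)
  have hbR : b ∉ R := Finset.notMem_erase _ _
  have hyR : y ∉ R := fun h => hyX (Finset.mem_of_mem_erase (Finset.mem_of_mem_erase h))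
  have hbX' : b ∈ X.erase a := Finset.mem_erase.2 ⟨hab.ne', hbX⟩
  have hXR : X = insert a (insert b R) := by
    rw [hR, Finset.insert_erase hbX', Finset.insert_erase haX]
  have hRX : R ⊆ X := (Finset.erase_subset _ _).trans (Finset.erase_subset _ _)
  have hRc : #R + 2 = n + 1 := by
    rw [← hX, hXR, Finset.card_insert_of_notMem (by simp [hab.ne, haR]),
      Finset.card_insert_of_notMem hbR]
  have step : ∀ c ∈ X, c ∉ R → c ≠ y → c ∉ A →
      0 ≤ divDiff (insert c (insert y R)) fun x => if x < β then F x else (interp A F).eval x := by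
    intro c hcX hcR hcy hcA
    refine ih _ ?_ _ ?_ ?_ ?_ rfl
    · rw [← h]
      apply Finset.card_lt_card
      rw [Finset.ssubset_iff_of_subset]
      · exact ⟨y, by simp [hyA, hyX], by simp⟩
      · intro z hz
        rw [Finset.mem_sdiff] at hz ⊢
        refine ⟨hz.1, fun hzX => hz.2 ?_⟩
        rw [hXR] at hzX
        simp only [Finset.mem_insert] at hzX ⊢
        rcases hzX with rfl | rfl | hz'
        · exact absurd hz.1 haA
        · exact absurd hz.1 hbA
        · exact Or.inr (Or.inr hz')
    · rw [Finset.card_insert_of_notMem (by simp [hcy, hcR]),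
        Finset.card_insert_of_notMem hyR]
      omega
    · intro x hx hxβ
      simp only [Finset.mem_insert] at hx
      rcases hx with rfl | rfl | hx
      · exact hXD _ hcX hxβ
      · exact hAD _ hyA
      · exact hXD _ (hRX hx) hxβ
    · intro x hx hxβ
      simp only [Finset.mem_insert] at hx
      rcases hx with rfl | rfl | hx
      · exact hXA _ hcX hxβ
      · exact Or.inl hyA
      · exact hXA _ (hRX hx) hxβ
  have key := sub_mul_divDiff_three hab.ne hay.ne hyb.ne' haR hbR hyR
    fun x => if x < β then F x else (interp A F).eval x
  rw [hXR]
  refine nonneg_of_mul_nonneg_right (a := b - a) ?_ (sub_pos.2 hab)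
  rw [key]
  refine add_nonneg (mul_nonneg (sub_pos.2 hay).le (step a haX haR hay.ne haA))
    (mul_nonneg (sub_pos.2 hyb).le ?_)
  rw [Finset.insert_comm]
  exact step b hbX hbR hyb.ne' hbA

/-- Truncated powers are `n`-convex. -/
theorem nConvexOn_truncatedPower (m : ℕ) (β : ℝ) :
    NConvexOn (m + 1) Set.univ fun x => if x < β then 0 else (x - β) ^ m := by
  intro X hXu hX
  clear hXu
  induction m generalizing X with
  | zero =>
    simp only [zero_add, pow_zero] at hX ⊢
    obtain ⟨a, b, hab, rfl⟩ := Finset.card_eq_two.1 hX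
    wlog hlt : a < b generalizing a b
    · have := this b a hab.symm (by rw [Finset.pair_comm]; exact hX)
        (lt_of_le_of_ne (not_lt.1 hlt) hab.symm)
      rwa [Finset.pair_comm]
    have h := sub_mul_divDiff_insert_insert (R := ∅) hab (by simp) (by simp)
      fun x => if x < β then (0 : ℝ) else 1
    simp only [insert_empty_eq, divDiff_singleton] at h
    refine nonneg_of_mul_nonneg_right (a := b - a) ?_ (sub_pos.2 hlt)
    rw [h]
    split_ifs <;> linarith
  | succ m ih =>
    by_cases h1 : ∀ x ∈ X, x < β
    · rw [divDiff_congr (g := fun x => (0 : ℝ[X]).eval x) fun x hx => by simp [h1 x hx]]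
      exact (divDiff_eval_eq_zero hX (by
        rw [Polynomial.degree_zero]
        exact WithBot.bot_lt_coe (m + 1 + 1))).ge
    by_cases h2 : ∀ x ∈ X, β ≤ x
    · rw [divDiff_congr (g := fun x => ((Polynomial.X - C β : ℝ[X]) ^ (m + 1)).eval x)
        fun x hx => by simp [(h2 x hx).not_gt]]
      refine (divDiff_eval_eq_zero hX ?_).ge
      rw [Polynomial.degree_pow, Polynomial.degree_X_sub_C, nsmul_one]
      exact_mod_cast Nat.lt_succ_self _
    push Not at h1 h2
    obtain ⟨b, hbX, hβb⟩ := h1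
    obtain ⟨a, haX, haβ⟩ := h2
    have hab : a < b := haβ.trans_le hβb
    set R := (X.erase a).erase b with hR
    have haR : a ∉ R := fun h => Finset.notMem_erase a X (Finset.mem_of_mem_erase h)
    have hbR : b ∉ R := Finset.notMem_erase _ _
    have hbX' : b ∈ X.erase a := Finset.mem_erase.2 ⟨hab.ne', hbX⟩
    have hXR : X = insert a (insert b R) := by
      rw [hR, Finset.insert_erase hbX', Finset.insert_erase haX]
    have ha' : a ∉ insert b R := by simp [hab.ne, haR]
    have hRc : #R = m + 1 := by
      rw [hXR, Finset.card_insert_of_notMem ha', Finset.card_insert_of_notMem hbR] at hX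
      omega
    set q : ℝ → ℝ := fun x => if x < β then 0 else (x - β) ^ m with hq
    -- Splitting x - β as (x - a) + (a - β) lets `divDiff_sub_mul` remove the node a from the first
    -- term.
    have e : (fun x => if x < β then 0 else (x - β) ^ (m + 1)) =
        fun x => (x - a) * q x + (a - β) * q x := by
      ext x
      simp only [hq]
      split_ifs <;> ring
    have h3 := sub_mul_divDiff_insert_insert hab.ne haR hbR q
    have h4 : 0 ≤ divDiff (insert b R) q := ih _ (by
      rw [Finset.card_insert_of_notMem hbR, hRc])
    have h5 : 0 ≤ divDiff (insert a R) q := ih _ (by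
      rw [Finset.card_insert_of_notMem haR, hRc])
    rw [e, divDiff_add, divDiff_const_mul, hXR, divDiff_sub_mul ha']
    refine nonneg_of_mul_nonneg_right (a := b - a) ?_ (sub_pos.2 hab)
    -- Since a < β ≤ b, both weights on the right are nonnegative.
    have h6 : (b - a) * (divDiff (insert b R) q + (a - β) * divDiff (insert a (insert b R)) q) =
        (b - β) * divDiff (insert b R) q + (β - a) * divDiff (insert a R) q := by
      linear_combination (a - β) * h3
    rw [h6]
    exact add_nonneg (mul_nonneg (sub_nonneg.2 hβb) h4) (mul_nonneg (sub_pos.2 haβ).le h5)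

/-- Beyond an interior point `β` of an interval, an `n`-convex function can be replaced by a
polynomial of degree less than `n` which lies below it. -/
theorem NConvexOn.exists_truncation {n : ℕ} {J : Set ℝ} (hJ : J.OrdConnected) {F : ℝ → ℝ}
    (hF : NConvexOn n J F) {p β c : ℝ} (hp : p ∈ J) (hc : c ∈ J) (hpβ : p < β) (hβc : β < c) :
    ∃ Q : ℝ[X], Q.degree < n ∧
      NConvexOn n {x | x < β → x ∈ J} (fun x => if x < β then F x else Q.eval x) ∧
      ∀ x ∈ J, β ≤ x → Q.eval x ≤ F x := by
  -- A sequence in J increasing from p to β. The polynomials `L k` interpolate F at n consecutive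
  -- terms; at each x ≥ β they increase with k, at points of J they stay below F, and Q is their
  -- limit.
  set s : ℕ → ℝ := fun m => β - (β - p) / (m + 1) with hs
  have hsβ : ∀ m, s m < β := fun m => by
    have : 0 < (β - p) / ((m : ℝ) + 1) := div_pos (sub_pos.2 hpβ) (by positivity)
    simp only [hs]
    linarith
  have hsm : StrictMono s := by
    refine strictMono_nat_of_lt_succ fun m => ?_
    simp only [hs]
    have : (β - p) / (((m + 1 : ℕ) : ℝ) + 1) < (β - p) / ((m : ℝ) + 1) :=
      div_lt_div_of_pos_left (sub_pos.2 hpβ) (by positivity) (by push_cast; linarith)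
    linarith
  have hst : Tendsto s atTop (𝓝 β) := by
    have h1 := (tendsto_one_div_add_atTop_nhds_zero_nat (𝕜 := ℝ)).const_mul (β - p)
    have h2 := h1.const_sub β
    simpa [hs, div_eq_mul_inv] using h2
  have hsJ : ∀ m, s m ∈ J := fun m => by
    refine hJ.out hp hc ⟨?_, ((hsβ m).trans hβc).le⟩
    have h0 : s 0 = p := by simp [hs]
    exact h0 ▸ hsm.monotone (Nat.zero_le m)
  set W : ℕ → Finset ℝ := fun k => (Finset.Ico k (k + n)).image s with hW
  have hWc : ∀ k, #(W k) = n := fun k => by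
    rw [hW, Finset.card_image_of_injective _ hsm.injective]
    simp
  have hWβ : ∀ k, ∀ a ∈ W k, a < β := fun k a ha => by
    obtain ⟨j, -, rfl⟩ := Finset.mem_image.1 ha
    exact hsβ j
  have hWJ : ∀ k, ∀ a ∈ W k, a ∈ J := fun k a ha => by
    obtain ⟨j, -, rfl⟩ := Finset.mem_image.1 ha
    exact hsJ j
  set L : ℕ → ℝ[X] := fun k => interp (W k) F with hL
  have hLdeg : ∀ k, (L k).degree < n := fun k => (hWc k) ▸ degree_interp_lt (W k) F
  have hmono : ∀ x, β ≤ x → Monotone fun k => (L k).eval x := by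
    intro x hx
    refine monotone_nat_of_le_succ fun k => ?_
    rcases Nat.eq_zero_or_pos n with hn | hn
    · have : W k = W (k + 1) := by simp [hW, hn]
      simp only [hL, this, le_refl]
    -- R is the common part of two successive windows. Dropping s k and adding s (k + n) changes the
    -- interpolant by a divided difference of order n times factors that are positive at x.
    set R := (Finset.Ico (k + 1) (k + n)).image s with hR
    have e1 : W k = insert (s k) R := by
      rw [hW, hR, ← Finset.image_insert, Finset.insert_Ico_add_one_left_eq_Ico (by omega)]
    have e2 : W (k + 1) = insert (s (k + n)) R := by
      have : Finset.Ico (k + 1) (k + 1 + n) = insert (k + n) (Finset.Ico (k + 1) (k + n)) := by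
        ext j
        simp only [Finset.mem_Ico, Finset.mem_insert]
        omega
      rw [hW, hR, ← Finset.image_insert, ← this]
    have hRlt : ∀ r ∈ R, r < x := fun r hr => by
      obtain ⟨j, -, rfl⟩ := Finset.mem_image.1 hr
      exact (hsβ j).trans_le hx
    have hk : s k ∉ R := by
      intro h
      obtain ⟨j, hj, hjk⟩ := Finset.mem_image.1 h
      rw [hsm.injective hjk, Finset.mem_Ico] at hj
      omega
    have hkn : s (k + n) ∉ R := by
      intro h
      obtain ⟨j, hj, hjk⟩ := Finset.mem_image.1 h
      rw [hsm.injective hjk, Finset.mem_Ico] at hj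
      omega
    have hne : s k < s (k + n) := hsm (by omega)
    have hxR : x ∉ R := fun h => lt_irrefl _ (hRlt x h)
    have i1 := eval_interp_insert_sub hk hxR ((hsβ k).trans_le hx).ne' F
    have i2 := eval_interp_insert_sub hkn hxR ((hsβ (k + n)).trans_le hx).ne' F
    have i3 := sub_mul_divDiff_insert_insert hne.ne hk hkn F
    have hkR : s k ∉ insert (s (k + n)) R := by simp [hne.ne, hk]
    have i4 : 0 ≤ divDiff (insert (s k) (insert (s (k + n)) R)) F := by
      refine hF _ ?_ ?_
      · intro y hy
        simp only [Finset.coe_insert, Set.mem_insert_iff, Finset.mem_coe] at hy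
        rcases hy with rfl | rfl | hy
        · exact hsJ _
        · exact hsJ _
        · obtain ⟨j, -, rfl⟩ := Finset.mem_image.1 hy
          exact hsJ j
      · rw [Finset.card_insert_of_notMem hkR, ← e2, hWc]
    have i5 : (L (k + 1)).eval x - (L k).eval x = (∏ r ∈ R, (x - r)) *
        ((s (k + n) - s k) * divDiff (insert (s k) (insert (s (k + n)) R)) F) := by
      simp only [hL, e1, e2]
      rw [i3]
      linear_combination i2 - i1
    rw [← sub_nonneg, i5]
    exact mul_nonneg (Finset.prod_nonneg fun r hr => (sub_pos.2 (hRlt r hr)).le)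
      (mul_nonneg (sub_pos.2 hne).le i4)
  have hle : ∀ k, ∀ x ∈ J, β ≤ x → (L k).eval x ≤ F x := fun k x hx hβx =>
    hF.eval_interp_le_of_forall_lt (hWc k) (hWJ k) hx fun a ha => (hWβ k a ha).trans_le hβx
  have hlim : ∀ x ∈ J, β ≤ x → Tendsto (fun k => (L k).eval x) atTop (𝓝 (⨆ k, (L k).eval x)) :=
    fun x hx hβx => tendsto_atTop_ciSup (hmono x hβx)
      ⟨F x, by rintro _ ⟨k, rfl⟩; exact hle k x hx hβx⟩
  -- Polynomials of degree < n depend linearly on their values at n points. Taking these in [β, c] ⊆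
  -- J, where F bounds the sequence, gives convergence at every real x, also outside J.
  obtain ⟨E, hEsub, hE⟩ := (Set.Icc_infinite hβc).exists_subset_card_eq n
  have hEJ : ∀ x ∈ E, x ∈ J := fun x hx => hJ.out hp hc ⟨hpβ.le.trans (hEsub hx).1, (hEsub hx).2⟩
  set Q : ℝ[X] := interp E fun x => ⨆ k, (L k).eval x with hQ
  have hQlim : ∀ x, Tendsto (fun k => (L k).eval x) atTop (𝓝 (Q.eval x)) := by
    intro x
    have h1 : ∀ k, (L k).eval x =
        ∑ a ∈ E, (Lagrange.basis E id a).eval x * (L k).eval a := fun k => by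
      conv_lhs => rw [← interp_eval (A := E) (P := L k) (hE ▸ hLdeg k)]
      exact eval_interp_eq_sum E _ x
    simp only [h1]
    rw [hQ, eval_interp_eq_sum]
    exact tendsto_finsetSum _ fun a ha => (hlim a (hEJ a ha) (hEsub ha).1).const_mul _
  refine ⟨Q, hE ▸ degree_interp_lt E _, ?_, ?_⟩
  · intro X hXJ hX
    have h1 : Tendsto (fun k => divDiff X fun x => if x < β then F x else (L k).eval x) atTop
        (𝓝 (divDiff X fun x => if x < β then F x else Q.eval x)) := by
      unfold divDiff
      refine tendsto_finsetSum _ fun x _ => Tendsto.div_const ?_ _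
      dsimp only
      split_ifs
      · exact tendsto_const_nhds
      · exact hQlim x
    -- For large k the points of X below β lie to the left of all nodes, as `divDiff_glue_nonneg`
    -- requires.
    have h2 : ∀ᶠ k in atTop, ∀ x ∈ X, x < β → x < s k := by
      rw [Filter.eventually_all_finset]
      intro x _
      by_cases hx : x < β
      · filter_upwards [hst.eventually (lt_mem_nhds hx)] with k hk _ using hk
      · exact Eventually.of_forall fun k h => absurd h hx
    refine ge_of_tendsto h1 ?_
    filter_upwards [h2] with k hk
    refine divDiff_glue_nonneg hF (hWc k) (hWβ k) X hX (fun x hx => hXJ hx) (hWJ k) ?_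
    intro x hx hxβ
    refine Or.inr fun a ha => ?_
    obtain ⟨j, hj, rfl⟩ := Finset.mem_image.1 ha
    exact (hk x hx hxβ).trans_le (hsm.monotone (Finset.mem_Ico.1 hj).1)
  · exact fun x hx hβx => le_of_tendsto' (hQlim x) fun k => hle k x hx hβx

theorem degree_C_mul_lt {n : ℕ} {P : ℝ[X]} (hP : P.degree < n) (c : ℝ) :
    (C c * P).degree < n := by
  rw [← Polynomial.smul_eq_C_mul]
  exact (Polynomial.degree_smul_le _ _).trans_lt hP

/-- A greatest element b of J may be an atom of τ, and there truncation gives only Q(b) ≤ F(b), for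
every cut. A multiple of the truncated power of exponent n - 1 restores equality at b and keeps
n-convexity. The constant M makes the upper bound independent of β, ready for dominated convergence.
-/
theorem NConvexOn.exists_corrected_truncation {n : ℕ} (hn : 1 ≤ n) {J : Set ℝ}
    (hJ : J.OrdConnected) {F : ℝ → ℝ} (hF : NConvexOn n J F) {A : Finset ℝ} (hA : #A = n)
    (hAJ : ∀ a ∈ A, a ∈ J) {M : ℝ} (hM0 : 0 ≤ M)
    (hM : ∀ b ∈ J, (∀ x ∈ J, x ≤ b) → F b - (interp A F).eval b ≤ M) {p β c : ℝ} (hp : p ∈ J)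
    (hc : c ∈ J) (hpβ : p < β) (hβc : β < c) (hAβ : ∀ a ∈ A, a < β) :
    ∃ Q : ℝ[X], Q.degree < n ∧
      NConvexOn n {x | x < β → x ∈ J} (fun x => if x < β then F x else Q.eval x) ∧
      ∀ x ∈ J, β ≤ x → (interp A F).eval x ≤ Q.eval x ∧ Q.eval x ≤ F x + M ∧
        ((∀ y ∈ J, y ≤ x) → Q.eval x = F x) := by
  obtain ⟨Q, hQ, hG, hQF⟩ := hF.exists_truncation hJ hp hc hpβ hβc
  have hPQ : ∀ x ∈ J, β ≤ x → (interp A F).eval x ≤ Q.eval x := by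
    intro x hx hβx
    have h1 := hG.eval_interp_le_of_forall_lt hA (fun a ha _ => hAJ a ha) (x := x)
      (fun _ => hx) fun a ha => (hAβ a ha).trans_le hβx
    rw [if_neg hβx.not_gt] at h1
    rwa [interp_congr (g := F) fun a ha => if_pos (hAβ a ha)] at h1
  by_cases hmax : ∃ b ∈ J, ∀ x ∈ J, x ≤ b
  · obtain ⟨b, hb, hbmax⟩ := hmax
    have hβb : β < b := hβc.trans_le (hbmax c hc)
    obtain ⟨m, rfl⟩ : ∃ m, n = m + 1 := ⟨n - 1, by omega⟩
    have hpow : 0 < (b - β) ^ m := pow_pos (sub_pos.2 hβb) m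
    -- Chosen so that the correction at b is exactly the defect F b - Q b.
    set κ := (F b - Q.eval b) / (b - β) ^ m with hκ
    have hκ0 : 0 ≤ κ := div_nonneg (sub_nonneg.2 (hQF b hb hβb.le)) hpow.le
    have hκb : κ * (b - β) ^ m = F b - Q.eval b := div_mul_cancel₀ _ hpow.ne'
    refine ⟨Q + C κ * (X - C β) ^ m, ?_, ?_, ?_⟩
    · refine (Polynomial.degree_add_le _ _).trans_lt (max_lt hQ ?_)
      refine degree_C_mul_lt ?_ _
      rw [Polynomial.degree_pow, Polynomial.degree_X_sub_C, nsmul_one]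
      exact_mod_cast Nat.lt_succ_self _
    · have h1 := hG.add (((nConvexOn_truncatedPower m β).mono (Set.subset_univ _)).const_mul hκ0)
      refine h1.congr fun x _ => ?_
      split_ifs <;> simp
    · intro x hx hβx
      have h1 : 0 ≤ κ * (x - β) ^ m := mul_nonneg hκ0 (pow_nonneg (sub_nonneg.2 hβx) m)
      have h2 : κ * (x - β) ^ m ≤ κ * (b - β) ^ m := by
        have := sub_nonneg.2 hβx
        have := hbmax x hx
        gcongr
      have e : (Q + C κ * (X - C β) ^ m).eval x = Q.eval x + κ * (x - β) ^ m := by simp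
      rw [e]
      refine ⟨by linarith [hPQ x hx hβx], ?_, fun hxmax => ?_⟩
      · linarith [hM b hb hbmax, hQF x hx hβx, hPQ b hb hβb.le]
      · have : x = b := le_antisymm (hbmax x hx) (hxmax b hb)
        rw [this, hκb]
        ring
  · exact ⟨Q, hQ, hG, fun x hx hβx => ⟨hPQ x hx hβx, by linarith [hQF x hx hβx],
      fun h => absurd ⟨x, hx, h⟩ hmax⟩⟩

/-! ### Approximation in mean by n-convex functions on the line -/

theorem integrable_eval {n : ℕ} {τ : Measure ℝ} (hmom : ∀ k < n, Integrable (fun x : ℝ => x ^ k) τ)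
    {P : ℝ[X]} (hP : P.degree < n) : Integrable (fun x => P.eval x) τ := by
  rcases eq_or_ne P 0 with rfl | h0
  · simp
  have h1 : P.natDegree < n := (Polynomial.natDegree_lt_iff_degree_lt h0).2 hP
  simp only [Polynomial.eval_eq_sum_range' h1]
  exact integrable_finsetSum _ fun k hk => (hmom k (Finset.mem_range.1 hk)).const_mul _

/-- As the cut moves to the right end of J, the modified function eventually equals F at every point
that is not greatest in J, and always equals F at a greatest point. It differs from F by at most |P|
+ 2|F| + M, so dominated convergence applies. -/
theorem exists_right_extension {n : ℕ} (hn : 1 ≤ n) {J : Set ℝ} (hJ : J.OrdConnected)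
    {τ : Measure ℝ} [IsFiniteMeasure τ] (hτJ : ∀ᵐ x ∂τ, x ∈ J)
    (hmom : ∀ k < n, Integrable (fun x : ℝ => x ^ k) τ) {F : ℝ → ℝ} (hF : NConvexOn n J F)
    (hFi : Integrable F τ) {p c : ℝ} (hp : p ∈ J) (hc : c ∈ J) (hpc : p < c) {ε : ℝ}
    (hε : 0 < ε) :
    ∃ (β : ℝ) (Q : ℝ[X]), p < β ∧ Q.degree < n ∧
      NConvexOn n {x | ∃ y ∈ J, y ≤ x} (fun x => if x < β then F x else Q.eval x) ∧
      Integrable (fun x => if x < β then F x else Q.eval x) τ ∧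
      ∫ x, |(if x < β then F x else Q.eval x) - F x| ∂τ < ε := by
  set p' := (p + c) / 2 with hp'
  have hpp' : p < p' := by rw [hp']; linarith
  have hp'c : p' < c := by rw [hp']; linarith
  obtain ⟨A, hAsub, hA⟩ := (Set.Icc_infinite hpp').exists_subset_card_eq n
  have hAJ : ∀ a ∈ A, a ∈ J := fun a ha => hJ.out hp hc ⟨(hAsub ha).1, (hAsub ha).2.trans hp'c.le⟩
  set P := interp A F with hP
  obtain ⟨M, hM0, hM⟩ : ∃ M : ℝ, 0 ≤ M ∧
      ∀ b ∈ J, (∀ x ∈ J, x ≤ b) → F b - (interp A F).eval b ≤ M := by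
    by_cases hmax : ∃ b ∈ J, ∀ x ∈ J, x ≤ b
    · obtain ⟨b, hb, hbmax⟩ := hmax
      refine ⟨max 0 (F b - (interp A F).eval b), le_max_left _ _, fun b' hb' h' => ?_⟩
      rw [le_antisymm (hbmax b' hb') (h' b hb)]
      exact le_max_right _ _
    · exact ⟨0, le_rfl, fun b hb h => absurd ⟨b, hb, h⟩ hmax⟩
  -- Cuts are rational so that `atTop` is countably generated, as dominated convergence demands.
  let ι := {q : ℚ // p' < (q : ℝ) ∧ ∃ d ∈ J, (q : ℝ) < d}
  have hne : Nonempty ι := by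
    obtain ⟨q, h1, h2⟩ := exists_rat_btwn hp'c
    exact ⟨⟨q, h1, c, hc, h2⟩⟩
  have hex : ∀ q : ι, ∃ Q : ℝ[X], Q.degree < n ∧
      NConvexOn n {x | x < ((q : ℚ) : ℝ) → x ∈ J}
        (fun x => if x < ((q : ℚ) : ℝ) then F x else Q.eval x) ∧
      ∀ x ∈ J, ((q : ℚ) : ℝ) ≤ x → (interp A F).eval x ≤ Q.eval x ∧ Q.eval x ≤ F x + M ∧
        ((∀ y ∈ J, y ≤ x) → Q.eval x = F x) := by
    rintro ⟨q, h1, d, hd, h2⟩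
    exact hF.exists_corrected_truncation hn hJ hA hAJ hM0 hM hp hd (hpp'.trans h1) h2
      fun a ha => (hAsub ha).2.trans_lt h1
  choose Q hQ hG hQF using hex
  have hint : ∀ q : ι, Integrable (fun x => if x < ((q : ℚ) : ℝ) then F x else (Q q).eval x) τ := by
    intro q
    have h1 := (hFi.indicator (measurableSet_Iio (a := ((q : ℚ) : ℝ)))).add
      ((integrable_eval hmom (hQ q)).indicator (measurableSet_Ici (a := ((q : ℚ) : ℝ))))
    refine h1.congr (ae_of_all _ fun x => ?_)
    by_cases hx : x < ((q : ℚ) : ℝ)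
    · simp [hx]
    · simp [hx, not_lt.1 hx]
  have hlim : Tendsto (fun q : ι => ∫ x,
      |(if x < ((q : ℚ) : ℝ) then F x else (Q q).eval x) - F x| ∂τ)
      atTop (𝓝 (∫ _, (0 : ℝ) ∂τ)) := by
    refine tendsto_integral_filter_of_dominated_convergence
      (fun x => |P.eval x| + 2 * |F x| + M) ?_ ?_ ?_ ?_
    · exact Eventually.of_forall fun q => ((hint q).sub hFi).abs.aestronglyMeasurable
    · refine Eventually.of_forall fun q => ?_
      filter_upwards [hτJ] with x hx
      rw [Real.norm_eq_abs, abs_abs]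
      split_ifs with h
      · simp only [sub_self, abs_zero]
        positivity
      · obtain ⟨h1, h2, -⟩ := hQF q x hx (not_lt.1 h)
        rw [abs_le]
        constructor <;> linarith [neg_abs_le (P.eval x), le_abs_self (F x), neg_abs_le (F x),
          abs_nonneg (P.eval x), abs_nonneg (F x)]
    · exact (((integrable_eval hmom (hA ▸ degree_interp_lt A F)).abs.add (hFi.abs.const_mul 2)).add
        (integrable_const M))
    · filter_upwards [hτJ] with x hx
      refine tendsto_const_nhds.congr' ?_
      by_cases hxmax : ∀ y ∈ J, y ≤ x
      · refine Eventually.of_forall fun q => ?_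
        dsimp only
        split_ifs with h
        · simp
        · rw [(hQF q x hx (not_lt.1 h)).2.2 hxmax]
          simp
      · push Not at hxmax
        obtain ⟨d, hd, hxd⟩ := hxmax
        have h1 : max x p' < max d c := max_lt_max hxd hp'c
        obtain ⟨q, h2, h3⟩ := exists_rat_btwn h1
        have hdc : max d c ∈ J := by rcases max_choice d c with h | h <;> rw [h] <;> assumption
        filter_upwards [eventually_ge_atTop
          (⟨q, (le_max_right _ _).trans_lt h2, max d c, hdc, h3⟩ : ι)] with q' hq'
        have h4 : (q : ℝ) ≤ ((q' : ℚ) : ℝ) := by exact_mod_cast hq'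
        rw [if_pos (((le_max_left _ _).trans_lt h2).trans_le h4)]
        simp
  rw [integral_zero] at hlim
  obtain ⟨q, hq⟩ := (hlim.eventually (gt_mem_nhds hε)).exists
  refine ⟨q, Q q, hpp'.trans q.2.1, hQ q, (hG q).mono ?_, hint q, hq⟩
  rintro x ⟨y, hy, hyx⟩ hxq
  obtain ⟨d, hd, hqd⟩ := q.2.2
  exact hJ.out hy hd ⟨hyx, (hxq.trans hqd).le⟩

/-- Mirror image of the right extension: x ↦ (-1)^n F(-x) is again n-convex. -/
theorem exists_left_extension {n : ℕ} (hn : 1 ≤ n) {J : Set ℝ} (hJ : J.OrdConnected)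
    {τ : Measure ℝ} [IsFiniteMeasure τ] (hτJ : ∀ᵐ x ∂τ, x ∈ J)
    (hmom : ∀ k < n, Integrable (fun x : ℝ => x ^ k) τ) {F : ℝ → ℝ} (hF : NConvexOn n J F)
    (hFi : Integrable F τ) {p c : ℝ} (hp : p ∈ J) (hc : c ∈ J) (hpc : p < c) {ε : ℝ}
    (hε : 0 < ε) :
    ∃ (α : ℝ) (Q : ℝ[X]), α < c ∧ Q.degree < n ∧
      NConvexOn n {x | ∃ y ∈ J, x ≤ y} (fun x => if α < x then F x else Q.eval x) ∧
      Integrable (fun x => if α < x then F x else Q.eval x) τ ∧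
      ∫ x, |(if α < x then F x else Q.eval x) - F x| ∂τ < ε := by
  have hsq : ∀ y : ℝ, (-1) ^ n * ((-1) ^ n * y) = y := fun y => by
    rw [← mul_assoc, ← mul_pow]; simp
  have hme : MeasurableEmbedding (fun x : ℝ => -x) := (Homeomorph.neg ℝ).measurableEmbedding
  have hfin : IsFiniteMeasure (τ.map fun x => -x) :=
    Measure.isFiniteMeasure_map τ _
  have hJ' : (-J).OrdConnected := ⟨fun x hx y hy z hz => hJ.out hy hx
    ⟨neg_le_neg hz.2, neg_le_neg hz.1⟩⟩
  have hmom' : ∀ k < n, Integrable (fun x : ℝ => x ^ k) (τ.map fun x => -x) := by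
    intro k hk
    rw [hme.integrable_map_iff]
    have e : (fun x : ℝ => x ^ k) ∘ (fun x => -x) = fun x => (-1) ^ k * x ^ k := by
      ext x
      simp [neg_pow x k]
    rw [e]
    exact (hmom k hk).const_mul _
  have hFi' : Integrable (fun x => (-1) ^ n * F (-x)) (τ.map fun x => -x) := by
    rw [hme.integrable_map_iff]
    refine (hFi.const_mul ((-1) ^ n)).congr (ae_of_all _ fun x => ?_)
    simp
  obtain ⟨β, Q, hβ, hQ, hG, hGi, hGε⟩ := exists_right_extension hn hJ' (τ := τ.map fun x => -x)
    (by rw [hme.ae_map_iff]; simpa using hτJ) hmom' hF.reflect hFi' (p := -c) (c := -p)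
    (by simpa using hc) (by simpa using hp) (neg_lt_neg hpc) hε
  set G : ℝ → ℝ := fun x => if x < β then (-1) ^ n * F (-x) else Q.eval x with hGdef
  have key : ∀ x, (if -β < x then F x else (C ((-1) ^ n) * Q.comp (-X)).eval x) =
      (-1) ^ n * G (-x) := by
    intro x
    simp only [hGdef]
    by_cases h : -β < x
    · rw [if_pos h, if_pos (by linarith), hsq, neg_neg]
    · rw [if_neg h, if_neg (by linarith)]
      simp
  refine ⟨-β, C ((-1) ^ n) * Q.comp (-X), by linarith, ?_, ?_, ?_, ?_⟩
  · refine degree_C_mul_lt ?_ _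
    rcases eq_or_ne Q 0 with rfl | h0
    · simp
    · refine Polynomial.degree_le_natDegree.trans_lt ?_
      rw [Polynomial.natDegree_comp, Polynomial.natDegree_neg, Polynomial.natDegree_X, mul_one]
      exact_mod_cast (Polynomial.natDegree_lt_iff_degree_lt h0).2 hQ
  · simp only [key]
    refine hG.reflect.mono ?_
    rintro x ⟨y, hy, hxy⟩
    exact ⟨-y, by simpa using hy, neg_le_neg hxy⟩
  · simp only [key]
    rw [hme.integrable_map_iff] at hGi
    exact hGi.const_mul _
  · simp only [key]
    rw [hme.integral_map] at hGε
    refine lt_of_eq_of_lt (integral_congr_ae (ae_of_all _ fun x => ?_)) hGε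
    have : (-1) ^ n * G (-x) - F x = (-1) ^ n * (G (-x) - (-1) ^ n * F (- -x)) := by
      rw [mul_sub, hsq, neg_neg]
    dsimp only
    rw [this, abs_mul, abs_pow, abs_neg, abs_one, one_pow, one_mul]

theorem exists_eval_growth {n : ℕ} {P : ℝ[X]} (hP : P.degree < n) :
    ∃ K : ℝ, 0 ≤ K ∧ ∀ x, |P.eval x| ≤ K * (1 + |x| ^ (n - 1)) := by
  rcases eq_or_ne P 0 with rfl | h0
  · exact ⟨0, le_rfl, by simp⟩
  have h1 : P.natDegree < n := (Polynomial.natDegree_lt_iff_degree_lt h0).2 hP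
  refine ⟨∑ i ∈ Finset.range n, |P.coeff i|, by positivity, fun x => ?_⟩
  rw [Polynomial.eval_eq_sum_range' h1, Finset.sum_mul]
  refine (Finset.abs_sum_le_sum_abs _ _).trans (Finset.sum_le_sum fun i hi => ?_)
  rw [abs_mul, abs_pow]
  gcongr
  have hi' : i ≤ n - 1 := by have := Finset.mem_range.1 hi; omega
  rcases le_total |x| 1 with h | h
  · have := pow_le_one₀ (n := i) (abs_nonneg x) h
    have := pow_nonneg (abs_nonneg x) (n - 1)
    linarith
  · have := pow_le_pow_right₀ h hi'
    linarith

/-- With one node left of [a, b] and n nodes right of it, G is squeezed between two interpolation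
polynomials on the whole interval. -/
theorem NConvexOn.exists_bound {n : ℕ} (hn : 1 ≤ n) {G : ℝ → ℝ} (hG : NConvexOn n Set.univ G)
    (a b : ℝ) : ∃ K, ∀ x ∈ Set.Icc a b, |G x| ≤ K := by
  obtain ⟨E, hEsub, hE⟩ :=
    (Set.Icc_infinite (lt_add_one (max a b + 1))).exists_subset_card_eq n
  obtain ⟨e, he⟩ : E.Nonempty := Finset.card_pos.1 (by omega)
  have hb : ∀ y ∈ E, max a b + 1 ≤ y := fun y hy => (hEsub hy).1
  have hbe : b < e := by linarith [hb e he, le_max_right a b]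
  have ha : a - 1 ∉ E := fun h => by linarith [hb _ h, le_max_left a b]
  set U := insert (a - 1) E
  have hU : #U = n + 1 := by rw [Finset.card_insert_of_notMem ha, hE]
  obtain ⟨K1, hK1⟩ := (isCompact_Icc (a := a) (b := b)).exists_bound_of_continuousOn
    (interp (U.erase (a - 1)) G).continuous.continuousOn
  obtain ⟨K2, hK2⟩ := (isCompact_Icc (a := a) (b := b)).exists_bound_of_continuousOn
    (interp (U.erase e) G).continuous.continuousOn
  refine ⟨K1 + K2, fun x hx => ?_⟩
  have h := hG.interp_sandwich hU (Set.subset_univ _) (Finset.mem_insert_self _ _)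
    (Finset.mem_insert_of_mem he) (x := x) (by linarith [hx.1]) (by linarith [hx.2])
    (Set.mem_univ x)
  have h2 := abs_sub_le_of_between (z := 0) h
  simp only [sub_zero] at h2
  have h3 := hK1 x hx
  have h4 := hK2 x hx
  rw [Real.norm_eq_abs] at h3 h4
  linarith

theorem NConvexOn.monotone {G : ℝ → ℝ} (hG : NConvexOn 1 Set.univ G) : Monotone G := by
  intro a b hab
  rcases hab.eq_or_lt with rfl | hlt
  · exact le_rfl
  have h := sub_mul_divDiff_insert_insert (R := ∅) hlt.ne (by simp) (by simp) G
  simp only [insert_empty_eq, divDiff_singleton] at h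
  rw [← sub_nonneg, ← h]
  exact mul_nonneg (sub_pos.2 hlt).le (hG _ (Set.subset_univ _) (Finset.card_pair hlt.ne))

/-- Near z, G is squeezed between two interpolation polynomials that both have z as a node and so
take the value G z there. This needs z and a node on each side, hence n ≥ 2. -/
theorem NConvexOn.continuous {n : ℕ} (hn : 2 ≤ n) {G : ℝ → ℝ} (hG : NConvexOn n Set.univ G) :
    Continuous G := by
  rw [continuous_iff_continuousAt]
  intro z
  obtain ⟨E, hEsub, hE⟩ := (Set.Ici_infinite (z + 1)).exists_subset_card_eq (n - 1)
  obtain ⟨e, he⟩ : E.Nonempty := Finset.card_pos.1 (by omega)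
  have hb : ∀ y ∈ E, z + 1 ≤ y := fun y hy => hEsub hy
  have hzE : z ∉ E := fun h => by linarith [hb _ h]
  have hzE' : z - 1 ∉ insert z E := by
    rw [Finset.mem_insert, not_or]
    exact ⟨by linarith, fun h => by linarith [hb _ h]⟩
  set U := insert (z - 1) (insert z E) with hU
  have hUc : #U = n + 1 := by
    rw [Finset.card_insert_of_notMem hzE', Finset.card_insert_of_notMem hzE, hE]
    omega
  have hzU : z ∈ U := by simp [hU]
  have h1 : (interp (U.erase (z - 1)) G).eval z = G z :=
    eval_interp_of_mem (Finset.mem_erase.2 ⟨by linarith, hzU⟩) G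
  have h2 : (interp (U.erase e) G).eval z = G z :=
    eval_interp_of_mem (Finset.mem_erase.2 ⟨by linarith [hb e he], hzU⟩) G
  have hc : ∀ P : ℝ[X], P.eval z = G z → Tendsto (fun x => |P.eval x - G z|) (𝓝 z) (𝓝 0) := by
    intro P hP
    have h3 : Continuous fun x => |P.eval x - G z| := (P.continuous.sub continuous_const).abs
    have := h3.tendsto z
    rwa [hP, sub_self, abs_zero] at this
  have h3 := (hc _ h1).add (hc _ h2)
  rw [add_zero] at h3
  refine tendsto_iff_norm_sub_tendsto_zero.2 (squeeze_zero' (Eventually.of_forall fun _ =>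
    norm_nonneg _) ?_ h3)
  filter_upwards [Ioo_mem_nhds (show z - 1 < z by linarith) (show z < z + 1 by linarith)] with x hx
  exact abs_sub_le_of_between (hG.interp_sandwich hUc (Set.subset_univ _)
    (Finset.mem_insert_self _ _) (by simp [hU, he]) hx.1 (hx.2.trans_le (hb e he))
    (Set.mem_univ x))

theorem NConvexOn.measurable {n : ℕ} (hn : 1 ≤ n) {G : ℝ → ℝ} (hG : NConvexOn n Set.univ G) :
    Measurable G := by
  rcases hn.eq_or_lt with rfl | h
  · exact hG.monotone.measurable
  · exact (hG.continuous h).measurable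

/-- Integrable `n`-convex functions on an interval are approximated in mean by `n`-convex functions
on the line of growth at most `|x| ^ (n - 1)`. -/
theorem exists_global_approximation {n : ℕ} (hn : 1 ≤ n) {J : Set ℝ} (hJ : J.OrdConnected)
    {τ : Measure ℝ} [IsFiniteMeasure τ] (hτJ : ∀ᵐ x ∂τ, x ∈ J)
    (hmom : ∀ k < n, Integrable (fun x : ℝ => x ^ k) τ) {F : ℝ → ℝ} (hF : NConvexOn n J F)
    (hFi : Integrable F τ) {p c : ℝ} (hp : p ∈ J) (hc : c ∈ J) (hpc : p < c) {ε : ℝ}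
    (hε : 0 < ε) :
    ∃ G : ℝ → ℝ, NConvexOn n Set.univ G ∧ (∃ K, ∀ x, |G x| ≤ K * (1 + |x| ^ (n - 1))) ∧
      Integrable G τ ∧ ∫ x, |G x - F x| ∂τ < ε := by
  obtain ⟨β, Q, hβ, hQ, hG, hGi, hGε⟩ :=
    exists_right_extension hn hJ hτJ hmom hF hFi hp hc hpc (half_pos hε)
  -- The right extension is n-convex on the upward closure of J; extending that to the left reaches
  -- the whole line.
  have hJ1 : {x | ∃ y ∈ J, y ≤ x}.OrdConnected :=
    ⟨fun x ⟨y, hy, hyx⟩ z _ w hw => ⟨y, hy, hyx.trans hw.1⟩⟩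
  obtain ⟨α, Q', hα, hQ', hG', hGi', hGε'⟩ :=
    exists_left_extension hn hJ1 (hτJ.mono fun x hx => ⟨x, hx, le_rfl⟩) hmom hG hGi
      (p := p) (c := β) ⟨p, hp, le_rfl⟩ ⟨p, hp, hβ.le⟩ hβ (half_pos hε)
  set G1 : ℝ → ℝ := fun x => if x < β then F x else Q.eval x with hG1
  set G2 : ℝ → ℝ := fun x => if α < x then G1 x else Q'.eval x with hG2
  have hG2u : NConvexOn n Set.univ G2 := hG'.mono fun x _ =>
    ⟨max p x, ⟨p, hp, le_max_left _ _⟩, le_max_right _ _⟩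
  refine ⟨G2, hG2u, ?_, hGi', ?_⟩
  · obtain ⟨K1, hK1, h1⟩ := exists_eval_growth hQ
    obtain ⟨K2, hK2, h2⟩ := exists_eval_growth hQ'
    obtain ⟨K3, h3⟩ := hG2u.exists_bound hn α β
    refine ⟨K1 + K2 + |K3|, fun x => ?_⟩
    have h0 : 0 ≤ |x| ^ (n - 1) := by positivity
    have h4 : 0 ≤ K1 * (1 + |x| ^ (n - 1)) := by positivity
    have h5 : 0 ≤ K2 * (1 + |x| ^ (n - 1)) := by positivity
    have h6 : |K3| ≤ |K3| * (1 + |x| ^ (n - 1)) :=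
      le_mul_of_one_le_right (abs_nonneg _) (by linarith)
    have h7 := abs_nonneg K3
    rw [add_mul, add_mul]
    by_cases hx1 : α < x
    · by_cases hx2 : x < β
      · linarith [h3 x ⟨hx1.le, hx2.le⟩, le_abs_self K3]
      · have : G2 x = Q.eval x := by simp only [hG2, hG1, if_pos hx1, if_neg hx2]
        rw [this]
        linarith [h1 x]
    · have : G2 x = Q'.eval x := by simp only [hG2, if_neg hx1]
      rw [this]
      linarith [h2 x]
  · have h1 : ∫ x, |G2 x - F x| ∂τ ≤ ∫ x, (|G2 x - G1 x| + |G1 x - F x|) ∂τ := by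
      refine integral_mono (hGi'.sub hFi).abs ((hGi'.sub hGi).abs.add (hGi.sub hFi).abs)
        fun x => ?_
      exact abs_sub_le _ _ _
    have h2 : ∫ x, (|G2 x - G1 x| + |G1 x - F x|) ∂τ =
        ∫ x, |G2 x - G1 x| ∂τ + ∫ x, |G1 x - F x| ∂τ :=
      integral_add (hGi'.sub hGi).abs (hGi.sub hFi).abs
    linarith

/-! ### The difference of two ordered laws as a signed measure -/

/-- The polar decomposition of the difference of two finite measures. -/
theorem exists_sign_density {α : Type*} [MeasurableSpace α] (μ ν : Measure α) [IsFiniteMeasure μ]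
    [IsFiniteMeasure ν] :
    ∃ (τ : Measure α) (s : α → ℝ), IsFiniteMeasure τ ∧ Measurable s ∧ (∀ x, |s x| = 1) ∧
      τ ≤ μ + ν ∧ (μ = ν → τ = 0) ∧ ∀ g : α → ℝ, Integrable g μ → Integrable g ν →
        ∫ x, g x * s x ∂τ = ∫ x, g x ∂μ - ∫ x, g x ∂ν := by
  -- On h one has μ ≤ ν. The truncated differences μ - ν and ν - μ are the Jordan parts, carried by
  -- the complement of h and by h; τ is their sum.
  obtain ⟨h, hh⟩ := exists_isHahnDecomposition μ ν
  have h1 : (μ - ν) h = 0 := Measure.sub_apply_eq_zero_of_isHahnDecomposition hh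
  have h2 : (ν - μ) hᶜ = 0 := Measure.sub_apply_eq_zero_of_isHahnDecomposition hh.compl
  have hle1 : μ - ν ≤ μ := Measure.sub_le
  have hle2 : ν - μ ≤ ν := Measure.sub_le
  classical
  set s : α → ℝ := h.piecewise (fun _ => -1) fun _ => 1 with hs
  have hsm : Measurable s := Measurable.piecewise hh.measurableSet measurable_const measurable_const
  have hs1 : ∀ x, |s x| = 1 := fun x => by
    by_cases hx : x ∈ h <;> simp [hs, hx]
  have hsum : (μ - ν) + ν = (ν - μ) + μ := by
    rw [← Measure.toSignedMeasure_eq_toSignedMeasure_iff, Measure.toSignedMeasure_add,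
      Measure.toSignedMeasure_add]
    have := Measure.sub_toSignedMeasure_eq_toSignedMeasure_sub (μ := μ) (ν := ν)
    rw [sub_eq_sub_iff_add_eq_add] at this
    rw [add_comm _ μ.toSignedMeasure, this]
  refine ⟨(μ - ν) + (ν - μ), s, inferInstance, hsm, hs1, add_le_add hle1 hle2, ?_, ?_⟩
  · rintro rfl
    simp
  · intro g hgμ hgν
    have hg1 : Integrable g (μ - ν) := hgμ.mono_measure hle1
    have hg2 : Integrable g (ν - μ) := hgν.mono_measure hle2
    have e1 : (fun x => g x * s x) =ᵐ[μ - ν] g := by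
      filter_upwards [measure_eq_zero_iff_ae_notMem.1 h1] with x hx
      simp [hs, hx]
    have e2 : (fun x => g x * s x) =ᵐ[ν - μ] fun x => -g x := by
      filter_upwards [measure_eq_zero_iff_ae_notMem.1 h2] with x hx
      have : x ∈ h := by simpa using hx
      simp [hs, this]
    rw [integral_add_measure (hg1.congr e1.symm) (hg2.neg.congr e2.symm), integral_congr_ae e1,
      integral_congr_ae e2, integral_neg]
    have h3 := integral_add_measure hg1 hgν
    have h4 := integral_add_measure hg2 hgμ
    rw [hsum, h4] at h3
    linarith

/-- The signed measure with total variation `τ` and sign `s` is nonnegative on `n`-convex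
functions. -/
structure SignedConvexOrder (n : ℕ) (I : Set ℝ) (τ : Measure ℝ) (s : ℝ → ℝ) : Prop where
  ae_mem : ∀ᵐ x ∂τ, x ∈ I
  measurable : Measurable s
  abs_eq_one : ∀ x, |s x| = 1
  integrable_pow : ∀ k < n, Integrable (fun x : ℝ => x ^ k) τ
  -- The interval J is free because the partial integrals in the induction on dimension are
  -- controlled only on an interval of integrable sections.
  integral_nonneg : ∀ J : Set ℝ, J.OrdConnected → (∀ᵐ x ∂τ, x ∈ J) → ∀ F : ℝ → ℝ,
    NConvexOn n J F → Integrable F τ → 0 ≤ ∫ x, F x * s x ∂τ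
  -- Supplies enough interpolation nodes inside any prescribed set of full measure.
  eq_zero_or : τ = 0 ∨ 1 ≤ n ∧ ∀ S : Set ℝ, (∀ᵐ x ∂τ, x ∈ S) →
    ∃ A : Finset ℝ, ↑A ⊆ S ∧ #A = n + 1

theorem MeasureTheory.Integrable.mul_of_abs_eq_one {α : Type*} [MeasurableSpace α]
    {τ : Measure α} {f s : α → ℝ}
    (hf : Integrable f τ) (hs : Measurable s) (hs1 : ∀ x, |s x| = 1) :
    Integrable (fun x => f x * s x) τ :=
  hf.mul_bdd (c := 1) hs.aestronglyMeasurable (ae_of_all _ fun x => (hs1 x).le)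

theorem integrable_pow_of_abs_pow {n : ℕ} {μ : Measure ℝ} [IsFiniteMeasure μ]
    (h : 1 ≤ n → Integrable (fun x : ℝ => |x| ^ (n - 1)) μ) :
    ∀ k < n, Integrable (fun x : ℝ => x ^ k) μ := by
  intro k hk
  refine ((integrable_const (1 : ℝ)).add (h (by omega))).mono' (by fun_prop)
    (ae_of_all _ fun x => ?_)
  rw [Real.norm_eq_abs, abs_pow, Pi.add_apply]
  rcases le_total |x| 1 with h | h
  · have := pow_le_one₀ (n := k) (abs_nonneg x) h
    have := pow_nonneg (abs_nonneg x) (n - 1)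
    linarith
  · have := pow_le_pow_right₀ h (show k ≤ n - 1 by omega)
    linarith

/-- Indicators are nonnegative, hence (-1)-convex, so ν ≤ μ on every measurable set; equal total
mass forces equality. -/
theorem eq_of_predConvexOrder_zero {I : Set ℝ} {μ ν : Measure ℝ} [IsProbabilityMeasure μ]
    [IsProbabilityMeasure ν] (h : PredConvexOrder 0 I ν μ) : ν = μ := by
  refine Measure.eq_of_le_of_isProbabilityMeasure (Measure.le_iff.2 fun B hB => ?_)
  have h1 := h (B.indicator fun _ => 1) ?_ ((integrable_const _).indicator hB)
    ((integrable_const _).indicator hB)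
  · rw [integral_indicator_const _ hB, integral_indicator_const _ hB] at h1
    simp only [smul_eq_mul, mul_one] at h1
    exact (ENNReal.toReal_le_toReal (measure_ne_top _ _) (measure_ne_top _ _)).1 h1
  · rw [predConvexOn_iff_nConvexOn]
    intro X _ hX
    obtain ⟨x, rfl⟩ := Finset.card_eq_one.1 hX
    rw [divDiff_singleton]
    exact Set.indicator_nonneg (fun _ _ => zero_le_one) x

/-- The polynomial vanishing on T \ {a} has degree < n and isolates the mass at a. -/
theorem measure_singleton_eq_zero_of_moments {n : ℕ} {τ : Measure ℝ} [IsFiniteMeasure τ]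
    {s : ℝ → ℝ} (hs1 : ∀ x, |s x| = 1)
    (hmom : ∀ P : ℝ[X], P.degree < n → ∫ x, P.eval x * s x ∂τ = 0) {T : Finset ℝ} (hT : #T ≤ n)
    (hτT : ∀ᵐ x ∂τ, x ∈ T) {a : ℝ} (ha : a ∈ T) : τ {a} = 0 := by
  set P : ℝ[X] := ∏ b ∈ T.erase a, (X - C b) with hP
  have hdeg : P.degree < n := by
    rw [hP, Polynomial.degree_prod]
    simp only [Polynomial.degree_X_sub_C, Finset.sum_const, nsmul_one]
    have h1 := Finset.card_erase_lt_of_mem ha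
    exact_mod_cast h1.trans_le hT
  have hPa : P.eval a ≠ 0 := by
    rw [hP, Polynomial.eval_prod, Finset.prod_ne_zero_iff]
    intro b hb
    simpa [sub_eq_zero] using (Finset.ne_of_mem_erase hb).symm
  have hsa : s a ≠ 0 := fun h => by simpa [h] using hs1 a
  have e : (fun x => P.eval x * s x) =ᵐ[τ] Set.indicator {a} fun _ => P.eval a * s a := by
    filter_upwards [hτT] with x hx
    by_cases hxa : x = a
    · simp [hxa]
    · have : P.eval x = 0 := by
        rw [hP, Polynomial.eval_prod]
        exact Finset.prod_eq_zero (Finset.mem_erase.2 ⟨hxa, hx⟩) (by simp)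
      simp [this, hxa]
  have h := hmom P hdeg
  rw [integral_congr_ae e, integral_indicator_const _ (measurableSet_singleton a)] at h
  simpa [measureReal_eq_zero_iff, hPa, hsa] using h

/-- A pair of laws in the `n`-convex order yields a signed measure which is nonnegative on
`n`-convex functions. -/
theorem exists_signedConvexOrder {n : ℕ} {I : Set ℝ} {μ ν : Measure ℝ}
    [IsProbabilityMeasure μ] [IsProbabilityMeasure ν] (hμI : ∀ᵐ x ∂μ, x ∈ I)
    (hνI : ∀ᵐ x ∂ν, x ∈ I) (hμ : 1 ≤ n → Integrable (fun x : ℝ => |x| ^ (n - 1)) μ)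
    (hν : 1 ≤ n → Integrable (fun x : ℝ => |x| ^ (n - 1)) ν) (h : PredConvexOrder n I ν μ) :
    ∃ (τ : Measure ℝ) (s : ℝ → ℝ), IsFiniteMeasure τ ∧ SignedConvexOrder n I τ s ∧
      ∀ B, MeasurableSet B → ∫ x in B, s x ∂τ = μ.real B - ν.real B := by
  obtain ⟨τ, s, hfin, hsm, hs1, hle, hzero, hint⟩ := exists_sign_density μ ν
  have hmomμ := integrable_pow_of_abs_pow hμ
  have hmomν := integrable_pow_of_abs_pow hν
  have hmomτ : ∀ k < n, Integrable (fun x : ℝ => x ^ k) τ := fun k hk =>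
    ((hmomμ k hk).add_measure (hmomν k hk)).mono_measure hle
  have hτI : ∀ᵐ x ∂τ, x ∈ I := by
    have h1 : ∀ᵐ x ∂(μ + ν), x ∈ I := by rw [ae_add_measure_iff]; exact ⟨hμI, hνI⟩
    exact (Measure.absolutelyContinuous_of_le hle).ae_le h1
  have hn : τ = 0 ∨ 1 ≤ n := by
    rcases Nat.eq_zero_or_pos n with rfl | hn
    · exact Or.inl (hzero (eq_of_predConvexOrder_zero h).symm)
    · exact Or.inr hn
  have hord : ∀ g, NConvexOn n Set.univ g → Integrable g μ → Integrable g ν →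
      0 ≤ ∫ x, g x * s x ∂τ := fun g hg hgμ hgν => by
    rw [hint g hgμ hgν, sub_nonneg]
    exact h g (predConvexOn_iff_nConvexOn.2 (hg.mono (Set.subset_univ _))) hgν hgμ
  -- Both P and -P are n-convex.
  have hpoly : ∀ P : ℝ[X], P.degree < n → ∫ x, P.eval x * s x ∂τ = 0 := by
    intro P hP
    have h1 : ∀ Q : ℝ[X], Q.degree < n → 0 ≤ ∫ x, Q.eval x * s x ∂τ := fun Q hQ =>
      hord _ (nConvexOn_eval hQ _) (integrable_eval hmomμ hQ) (integrable_eval hmomν hQ)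
    have h2 := h1 (-P) (by rwa [Polynomial.degree_neg])
    simp only [Polynomial.eval_neg, neg_mul, integral_neg] at h2
    linarith [h1 P hP]
  have hnodes : τ = 0 ∨ 1 ≤ n ∧ ∀ S : Set ℝ, (∀ᵐ x ∂τ, x ∈ S) →
      ∃ A : Finset ℝ, ↑A ⊆ S ∧ #A = n + 1 := by
    rcases hn with h0 | hn
    · exact Or.inl h0
    by_cases hS : ∀ S : Set ℝ, (∀ᵐ x ∂τ, x ∈ S) → ∃ A : Finset ℝ, ↑A ⊆ S ∧ #A = n + 1
    · exact Or.inr ⟨hn, hS⟩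
    left
    push Not at hS
    obtain ⟨S, hτS, hSA⟩ := hS
    have hSfin : S.Finite := by
      by_contra hinf
      obtain ⟨A, h1, h2⟩ := Set.Infinite.exists_subset_card_eq hinf (n + 1)
      exact hSA A h1 h2
    obtain ⟨T, rfl⟩ := hSfin.exists_finset_coe
    have hT : #T ≤ n := by
      by_contra! hlt
      obtain ⟨A, h1, h2⟩ := Finset.exists_subset_card_eq (show n + 1 ≤ #T from hlt)
      exact hSA A (Finset.coe_subset.2 h1) h2
    have h1 : τ T = 0 := by
      rw [← Set.biUnion_of_singleton (T : Set ℝ), measure_biUnion_null_iff T.countable_toSet]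
      exact fun a ha => measure_singleton_eq_zero_of_moments hs1 hpoly hT hτS ha
    rw [← Measure.measure_univ_eq_zero, ← Set.union_compl_self (T : Set ℝ)]
    exact measure_union_null h1 hτS
  refine ⟨τ, s, hfin, ⟨hτI, hsm, hs1, hmomτ, ?_, hnodes⟩, ?_⟩
  · intro J hJ hτJ F hF hFi
    rcases hnodes with rfl | ⟨hn, hnodes⟩
    · simp
    obtain ⟨A, hAJ, hA⟩ := hnodes J hτJ
    obtain ⟨p, c, hp, hc, hpc⟩ : ∃ p c, p ∈ A ∧ c ∈ A ∧ p < c := by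
      obtain ⟨p, hp, c, hc, hne⟩ := Finset.one_lt_card.1 (show 1 < #A by omega)
      rcases lt_or_gt_of_ne hne with h | h
      · exact ⟨p, c, hp, hc, h⟩
      · exact ⟨c, p, hc, hp, h⟩
    -- The approximant G is integrable under μ and ν by its growth, so the order applies to it; as
    -- |s| = 1, passing from G to F costs at most the L¹(τ) error.
    refine le_of_forall_pos_le_add fun ε hε => ?_
    obtain ⟨G, hG, ⟨K, hK⟩, hGτ, hGε⟩ :=
      exists_global_approximation hn hJ hτJ hmomτ hF hFi (hAJ hp) (hAJ hc) hpc hε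
    have hGi : ∀ (ρ : Measure ℝ) [IsFiniteMeasure ρ], Integrable (fun x : ℝ => |x| ^ (n - 1)) ρ →
        Integrable G ρ := fun ρ _ hρ =>
      (((integrable_const (1 : ℝ)).add hρ).const_mul K).mono'
        (hG.measurable hn).aestronglyMeasurable (ae_of_all _ hK)
    have h1 := hord G hG (hGi μ (hμ hn)) (hGi ν (hν hn))
    have h2 : ∫ x, G x * s x ∂τ - ∫ x, F x * s x ∂τ ≤ ∫ x, |G x - F x| ∂τ := by
      rw [← integral_sub (hGτ.mul_of_abs_eq_one hsm hs1) (hFi.mul_of_abs_eq_one hsm hs1)]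
      refine integral_mono ((hGτ.mul_of_abs_eq_one hsm hs1).sub (hFi.mul_of_abs_eq_one hsm hs1))
        (hGτ.sub hFi).abs fun x => ?_
      dsimp only
      rw [← sub_mul]
      refine (le_abs_self _).trans ?_
      rw [abs_mul, hs1, mul_one]
    linarith
  · intro B hB
    have h1 := hint (B.indicator fun _ => 1) ((integrable_const _).indicator hB)
      ((integrable_const _).indicator hB)
    rw [integral_indicator_const _ hB, integral_indicator_const _ hB] at h1
    simp only [smul_eq_mul, mul_one] at h1
    rw [← h1, ← integral_indicator hB]
    congr 1
    ext x
    by_cases hx : x ∈ B <;> simp [hx]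

/-! ### Jordan decomposition and integrals for the product signed measure -/

theorem integral_lsmul_toSignedMeasure {α : Type*} [MeasurableSpace α] (μ : Measure α)
    [IsFiniteMeasure μ] (f : α → ℝ) : ∫ᵛ x, f x ∂•μ.toSignedMeasure = ∫ x, f x ∂μ := by
  have h : (ContinuousLinearMap.lsmul ℝ ℝ : ℝ →L[ℝ] ℝ →L[ℝ] ℝ).flip =
      ContinuousLinearMap.lsmul ℝ ℝ := by
    ext
    simp
  rw [← VectorMeasure.integral_toSignedMeasure, h]

section Sign

variable {α : Type*} [MeasurableSpace α] (τ : Measure α) [IsFiniteMeasure τ] {s : α → ℝ}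

/-- The Jordan decomposition of the signed measure with total variation `τ` and sign `s`. -/
def signJordan (hs : Measurable s) : JordanDecomposition α where
  posPart := τ.restrict {x | s x = 1}
  negPart := τ.restrict {x | s x = 1}ᶜ
  mutuallySingular := by
    have hE : MeasurableSet {x | s x = 1} := hs (measurableSet_singleton 1)
    refine ⟨{x | s x = 1}ᶜ, hE.compl, ?_, ?_⟩
    · rw [Measure.restrict_apply hE.compl]
      simp
    · rw [compl_compl, Measure.restrict_apply hE]
      simp

theorem integral_signJordan (hs : Measurable s) (hs1 : ∀ x, |s x| = 1) {f : α → ℝ}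
    (hf : Integrable f τ) :
    ∫ x, f x ∂(signJordan τ hs).posPart - ∫ x, f x ∂(signJordan τ hs).negPart =
      ∫ x, f x * s x ∂τ := by
  have hE : MeasurableSet {x | s x = 1} := hs (measurableSet_singleton 1)
  have hi := hf.mul_of_abs_eq_one hs hs1
  rw [← integral_add_compl hE hi]
  change ∫ x in {x | s x = 1}, f x ∂τ - ∫ x in {x | s x = 1}ᶜ, f x ∂τ = _
  have h1 : ∫ x in {x | s x = 1}, f x * s x ∂τ = ∫ x in {x | s x = 1}, f x ∂τ :=
    setIntegral_congr_fun hE fun x hx => by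
      have : s x = 1 := hx
      simp [this]
  have h2 : ∫ x in {x | s x = 1}ᶜ, f x * s x ∂τ = ∫ x in {x | s x = 1}ᶜ, -f x ∂τ :=
    setIntegral_congr_fun hE.compl fun x hx => by
      have : s x = -1 := (eq_or_eq_neg_of_abs_eq (hs1 x)).resolve_left hx
      simp [this]
  rw [h1, h2, integral_neg, sub_eq_add_neg]

end Sign

section Product

variable {d : ℕ} {μ ν τ : Fin d → Measure ℝ} [∀ i, IsFiniteMeasure (μ i)]
  [∀ i, IsFiniteMeasure (ν i)] [∀ i, IsFiniteMeasure (τ i)] {s : Fin d → ℝ → ℝ}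

/-- Both sides factor over measurable boxes, a π-system that generates the σ-algebra and contains
the whole space. -/
theorem prodSignedDiff_eq_signJordan (hs1 : ∀ i x, |s i x| = 1)
    (h : ∀ i B, MeasurableSet B → ∫ x in B, s i x ∂τ i = (μ i).real B - (ν i).real B)
    (hm : Measurable fun x : Fin d → ℝ => ∏ i, s i (x i)) :
    prodSignedDiff μ ν = (signJordan (Measure.pi τ) hm).toSignedMeasure := by
  have hm1 : ∀ x : Fin d → ℝ, |∏ i, s i (x i)| = 1 := fun x => by simp [Finset.abs_prod, hs1]
  have key : ∀ B : Fin d → Set ℝ, (∀ i, MeasurableSet (B i)) →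
      prodSignedDiff μ ν (Set.univ.pi B) =
        (signJordan (Measure.pi τ) hm).toSignedMeasure (Set.univ.pi B) := by
    intro B hB
    have hBm : MeasurableSet (Set.univ.pi B) := MeasurableSet.univ_pi hB
    rw [prodSignedDiff_pi μ ν B hB, JordanDecomposition.toSignedMeasure,
      Measure.toSignedMeasure_sub_apply hBm]
    have h1 := integral_signJordan (Measure.pi τ) hm hm1
      (f := (Set.univ.pi B).indicator fun _ => 1) ((integrable_const _).indicator hBm)
    rw [integral_indicator_const _ hBm, integral_indicator_const _ hBm] at h1
    simp only [smul_eq_mul, mul_one] at h1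
    rw [h1]
    have h2 : ∀ x : Fin d → ℝ, (Set.univ.pi B).indicator (fun _ => (1 : ℝ)) x * ∏ i, s i (x i) =
        ∏ i, (B i).indicator (s i) (x i) := by
      intro x
      by_cases hx : x ∈ Set.univ.pi B
      · rw [Set.indicator_of_mem hx, one_mul]
        exact Finset.prod_congr rfl fun i _ => by
          rw [Set.indicator_of_mem (hx i (Set.mem_univ i))]
      · rw [Set.indicator_of_notMem hx, zero_mul]
        simp only [Set.mem_pi, Set.mem_univ, true_implies, not_forall] at hx
        obtain ⟨i, hi⟩ := hx
        exact (Finset.prod_eq_zero (Finset.mem_univ i) (Set.indicator_of_notMem hi _)).symm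
    simp only [h2]
    rw [integral_fintype_prod_eq_prod (fun i => (B i).indicator (s i))]
    exact Finset.prod_congr rfl fun i _ => by rw [integral_indicator (hB i), h i _ (hB i)]
  refine VectorMeasure.ext_of_generateFrom _ ?_ generateFrom_pi.symm isPiSystem_pi ?_
  · rintro _ ⟨B, hB, rfl⟩
    exact key B fun i => hB i (Set.mem_univ i)
  · have := key (fun _ => Set.univ) fun _ => MeasurableSet.univ
    rwa [Set.pi_univ] at this

theorem variation_prodSignedDiff (hs : ∀ i, Measurable (s i)) (hs1 : ∀ i x, |s i x| = 1)
    (h : ∀ i B, MeasurableSet B → ∫ x in B, s i x ∂τ i = (μ i).real B - (ν i).real B) :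
    (prodSignedDiff μ ν).variation = Measure.pi τ := by
  have hm : Measurable fun x : Fin d → ℝ => ∏ i, s i (x i) :=
    Finset.measurable_prod _ fun i _ => (hs i).comp (measurable_pi_apply i)
  rw [← SignedMeasure.totalVariation_eq_variation, prodSignedDiff_eq_signJordan hs1 h hm,
    SignedMeasure.totalVariation, JordanDecomposition.toJordanDecomposition_toSignedMeasure]
  exact Measure.restrict_add_restrict_compl (hm (measurableSet_singleton 1))

theorem integral_prodSignedDiff (hs : ∀ i, Measurable (s i)) (hs1 : ∀ i x, |s i x| = 1)
    (h : ∀ i B, MeasurableSet B → ∫ x in B, s i x ∂τ i = (μ i).real B - (ν i).real B)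
    {f : (Fin d → ℝ) → ℝ} (hf : Integrable f (Measure.pi τ)) :
    ∫ᵛ x, f x ∂•(prodSignedDiff μ ν) = ∫ x, f x * ∏ i, s i (x i) ∂Measure.pi τ := by
  have hm : Measurable fun x : Fin d → ℝ => ∏ i, s i (x i) :=
    Finset.measurable_prod _ fun i _ => (hs i).comp (measurable_pi_apply i)
  have hm1 : ∀ x : Fin d → ℝ, |∏ i, s i (x i)| = 1 := fun x => by simp [Finset.abs_prod, hs1]
  rw [prodSignedDiff_eq_signJordan hs1 h hm, JordanDecomposition.toSignedMeasure,
    VectorMeasure.integral_sub_vectorMeasure, integral_lsmul_toSignedMeasure,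
    integral_lsmul_toSignedMeasure, integral_signJordan _ hm hm1 hf]
  · rw [VectorMeasure.Integrable, Measure.variation_toSignedMeasure]
    exact hf.restrict
  · rw [VectorMeasure.Integrable, Measure.variation_toSignedMeasure]
    exact hf.restrict

theorem integrable_prodSignedDiff_of_forall {f : (Fin d → ℝ) → ℝ}
    (hf : ∀ A : Finset (Fin d), Integrable f (Measure.pi (mixMeasure A μ ν))) :
    (prodSignedDiff μ ν).Integrable f ∧ ∫ᵛ x, f x ∂•(prodSignedDiff μ ν) =
      ∑ A : Finset (Fin d), (-1 : ℝ) ^ #A * ∫ x, f x ∂Measure.pi (mixMeasure A μ ν) := by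
  have h1 : ∀ A ∈ (univ : Finset (Finset (Fin d))),
      ((-1 : ℝ) ^ #A • (Measure.pi (mixMeasure A μ ν)).toSignedMeasure).Integrable f := by
    intro A _
    refine VectorMeasure.Integrable.smul_vectorMeasure ?_ _
    rw [VectorMeasure.Integrable, Measure.variation_toSignedMeasure]
    exact hf A
  refine ⟨VectorMeasure.Integrable.finsetSum_vectorMeasure h1, ?_⟩
  rw [prodSignedDiff, VectorMeasure.integral_finsetSum_vectorMeasure h1]
  refine Finset.sum_congr rfl fun A _ => ?_
  rw [VectorMeasure.integral_smul_vectorMeasure, integral_lsmul_toSignedMeasure, smul_eq_mul]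

end Product

/-! ### Box-convexity in several variables -/

/-- Extension of a point of `ℝ ^ d` by a last coordinate. -/
abbrev snocR {d : ℕ} (y : Fin d → ℝ) (t : ℝ) : Fin (d + 1) → ℝ :=
  Fin.snoc (α := fun _ => ℝ) y t

/-- Box-convexity, with divided differences over finite sets of points. -/
def BoxDivConvex : (d : ℕ) → (n : Fin d → ℕ) → (I : Fin d → Set ℝ) → ((Fin d → ℝ) → ℝ) → Prop
  | 0, _, _, f => 0 ≤ f Fin.elim0
  | d + 1, n, I, f => ∀ T : Finset ℝ, ↑T ⊆ I (Fin.last d) → #T = n (Fin.last d) + 1 →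
      BoxDivConvex d (fun i => n i.castSucc) (fun i => I i.castSucc) fun y =>
        divDiff T fun t => f (snocR y t)

theorem dividedDiff_sum {ι : Type*} (n : ℕ) (x : Fin (n + 1) → ℝ) (A : Finset ι) (c : ι → ℝ)
    (g : ι → ℝ → ℝ) : dividedDiff n x (fun t => ∑ a ∈ A, c a * g a t) =
      ∑ a ∈ A, c a * dividedDiff n x (g a) := by
  induction n with
  | zero => rfl
  | succ n ih =>
    simp only [dividedDiff, ih]
    rw [← Finset.sum_sub_distrib, Finset.sum_div]
    exact Finset.sum_congr rfl fun a _ => by ring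

theorem multiDividedDiff_sum {ι : Type*} (d : ℕ) (n : Fin d → ℕ)
    (x : (i : Fin d) → Fin (n i + 1) → ℝ) (A : Finset ι) (c : ι → ℝ)
    (g : ι → (Fin d → ℝ) → ℝ) : multiDividedDiff d n x (fun y => ∑ a ∈ A, c a * g a y) =
      ∑ a ∈ A, c a * multiDividedDiff d n x (g a) := by
  induction d with
  | zero => rfl
  | succ d ih =>
    simp only [multiDividedDiff, ih]
    exact dividedDiff_sum _ _ _ _ _

theorem divDiff_eq_sum_mul (T : Finset ℝ) (h : ℝ → ℝ) :
    divDiff T h = ∑ t ∈ T, (∏ y ∈ T.erase t, (t - y))⁻¹ * h t :=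
  Finset.sum_congr rfl fun t _ => by rw [div_eq_mul_inv, mul_comm]

/-- `multiDividedDiff` applies the last variable outermost, `BoxDivConvex` innermost. Divided
differences are finite linear combinations of values, so the two orders agree. -/
theorem BoxConvexOn.boxDivConvex {d : ℕ} {n : Fin d → ℕ} {I : Fin d → Set ℝ}
    {f : (Fin d → ℝ) → ℝ} (hf : BoxConvexOn n I f) : BoxDivConvex d n I f := by
  induction d with
  | zero => exact hf (fun i => i.elim0) (fun i => i.elim0) fun i => i.elim0
  | succ d ih =>
    intro T hT hTc
    refine ih fun x hx hxI => ?_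
    obtain ⟨z, hz, rfl⟩ := exists_injective_image_eq hTc
    set w : (i : Fin (d + 1)) → Fin (n i + 1) → ℝ :=
      Fin.snoc (α := fun i => Fin (n i + 1) → ℝ) x z with hw
    have hw1 : w (Fin.last d) = z := Fin.snoc_last _ _
    have hw2 : ∀ i : Fin d, w i.castSucc = x i := fun i => Fin.snoc_castSucc _ _ _
    have h := hf w
      (fun i => by
        refine Fin.lastCases ?_ (fun i => ?_) i
        · rwa [hw1]
        · rw [hw2]
          exact hx i)
      (fun i => by
        refine Fin.lastCases ?_ (fun i => ?_) i
        · intro j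
          rw [hw1]
          exact hT (by simp)
        · intro j
          rw [hw2]
          exact hxI i j)
    rw [multiDividedDiff, hw1, dividedDiff_eq_divDiff _ _ hz] at h
    simp only [hw2] at h
    simp only [divDiff_eq_sum_mul] at h ⊢
    rwa [multiDividedDiff_sum]

theorem BoxDivConvex.congr {d : ℕ} {n : Fin d → ℕ} {I : Fin d → Set ℝ}
    {f g : (Fin d → ℝ) → ℝ} (hf : BoxDivConvex d n I f)
    (hfg : ∀ x, (∀ i, x i ∈ I i) → f x = g x) : BoxDivConvex d n I g := by
  induction d with
  | zero =>
    have h : 0 ≤ f Fin.elim0 := hf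
    rwa [hfg _ fun i => i.elim0] at h
  | succ d ih =>
    intro T hT hTc
    refine ih (hf T hT hTc) fun y hy => divDiff_congr fun t ht => hfg _ fun i => ?_
    refine Fin.lastCases ?_ (fun i => ?_) i
    · rw [snocR, Fin.snoc_last]
      exact hT ht
    · rw [snocR, Fin.snoc_castSucc]
      exact hy i

/-- The divided difference in coordinate i annihilates P(x_i) h(x), because h does not depend on
x_i. -/
theorem BoxDivConvex.sub_pseudopolynomial {d : ℕ} {n : Fin d → ℕ} {I : Fin d → Set ℝ}
    {f h : (Fin d → ℝ) → ℝ} (hf : BoxDivConvex d n I f) {i : Fin d} {P : ℝ[X]}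
    (hP : P.degree < n i) (hh : ∀ x b, h (Function.update x i b) = h x) :
    BoxDivConvex d n I fun x => f x - P.eval (x i) * h x := by
  induction d with
  | zero => exact i.elim0
  | succ d ih =>
    intro T hT hTc
    induction i using Fin.lastCases with
    | last =>
      refine (hf T hT hTc).congr fun y _ => ?_
      have h1 : ∀ t, h (snocR y t) = h (snocR y 0) := fun t => by
        rw [← hh (snocR y 0) t, Fin.update_snoc_last]
      simp only [snocR, Fin.snoc_last] at h1 ⊢
      simp only [h1]
      rw [divDiff_sub, divDiff_mul_const, divDiff_eval_eq_zero hTc hP]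
      ring
    | cast i =>
      have h1 := ih (hf T hT hTc) (i := i) hP (h := fun y => divDiff T fun t => h (snocR y t))
        fun y b => by simp only [snocR, Fin.snoc_update, hh]
      refine h1.congr fun y _ => ?_
      simp only [snocR, Fin.snoc_castSucc]
      rw [divDiff_sub, divDiff_const_mul]

/-- If no x_i is a node, take the points A i ∪ {x_i} in each coordinate: as f vanishes at nodes, the
multiple divided difference is f(x) divided by the double product, which therefore has a compatible
sign. -/
theorem BoxDivConvex.mul_prod_nonneg {d : ℕ} {n : Fin d → ℕ} {I : Fin d → Set ℝ}
    {f : (Fin d → ℝ) → ℝ} (hf : BoxDivConvex d n I f) {A : Fin d → Finset ℝ}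
    (hA : ∀ i, #(A i) = n i) (hAI : ∀ i, ↑(A i) ⊆ I i)
    (hfA : ∀ x, (∃ i, x i ∈ A i) → f x = 0) (x : Fin d → ℝ) (hx : ∀ i, x i ∈ I i) :
    0 ≤ f x * ∏ i, ∏ a ∈ A i, (x i - a) := by
  induction d with
  | zero =>
    have h : 0 ≤ f Fin.elim0 := hf
    rw [Subsingleton.elim x Fin.elim0]
    simpa using h
  | succ d ih =>
    by_cases hl : x (Fin.last d) ∈ A (Fin.last d)
    · rw [hfA x ⟨_, hl⟩, zero_mul]
    have h1 := ih (hf (insert (x (Fin.last d)) (A (Fin.last d)))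
      (by rw [Finset.coe_insert]; exact Set.insert_subset (hx _) (hAI _))
      (by rw [Finset.card_insert_of_notMem hl, hA])) (A := fun i => A i.castSucc)
      (fun i => hA _) (fun i => hAI _) ?_ (fun i => x i.castSucc) fun i => hx _
    · rw [divDiff_insert_of_eq_zero hl fun a ha => hfA _ ⟨Fin.last d, by simpa using ha⟩] at h1
      have e : snocR (fun i => x i.castSucc) (x (Fin.last d)) = x := Fin.snoc_init_self x
      rw [e] at h1
      rw [Fin.prod_univ_castSucc]
      set w := ∏ a ∈ A (Fin.last d), (x (Fin.last d) - a)
      have hw : w ≠ 0 :=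
        Finset.prod_ne_zero_iff.2 fun a ha => sub_ne_zero.2 fun h => hl (h ▸ ha)
      set v := ∏ i : Fin d, ∏ a ∈ A i.castSucc, (x i.castSucc - a)
      have : f x * (v * w) = f x / w * v * w ^ 2 := by
        field_simp
      rw [this]
      positivity
    · rintro y ⟨i, hi⟩
      rw [divDiff_congr (g := fun _ => 0 * 0) fun t _ => ?_, divDiff_const_mul, zero_mul]
      rw [mul_zero]
      exact hfA _ ⟨i.castSucc, by simpa using hi⟩

/-! ### Normalization by interpolation -/

theorem measurePreserving_insertNth {d : ℕ} (τ : Fin (d + 1) → Measure ℝ)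
    [∀ i, IsFiniteMeasure (τ i)] (i : Fin (d + 1)) :
    MeasurePreserving (fun p : ℝ × (Fin d → ℝ) => i.insertNth (α := fun _ => ℝ) p.1 p.2)
      ((τ i).prod (Measure.pi fun j => τ (i.succAbove j))) (Measure.pi τ) :=
  (measurePreserving_piFinSuccAbove τ i).symm (MeasurableEquiv.piFinSuccAbove (fun _ => ℝ) i)

theorem measurableEmbedding_insertNth {d : ℕ} (i : Fin (d + 1)) :
    MeasurableEmbedding fun p : ℝ × (Fin d → ℝ) => i.insertNth (α := fun _ => ℝ) p.1 p.2 :=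
  (MeasurableEquiv.piFinSuccAbove (fun _ => ℝ) i).symm.measurableEmbedding

theorem SignedConvexOrder.integral_eval_eq_zero {n : ℕ} {I : Set ℝ} {τ : Measure ℝ} {s : ℝ → ℝ}
    (H : SignedConvexOrder n I τ s) {P : ℝ[X]} (hP : P.degree < n) :
    ∫ x, P.eval x * s x ∂τ = 0 := by
  have h1 : ∀ Q : ℝ[X], Q.degree < n → 0 ≤ ∫ x, Q.eval x * s x ∂τ := fun Q hQ =>
    H.integral_nonneg Set.univ Set.ordConnected_univ (by simp) _ (nConvexOn_eval hQ _)
      (integrable_eval H.integrable_pow hQ)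
  have h2 := h1 (-P) (by rwa [Polynomial.degree_neg])
  simp only [Polynomial.eval_neg, neg_mul, integral_neg] at h2
  linarith [h1 P hP]

theorem degree_basis_lt {A : Finset ℝ} {a : ℝ} (ha : a ∈ A) :
    (Lagrange.basis A id a).degree < #A := by
  rw [Lagrange.degree_basis Function.injective_id.injOn ha]
  have := Finset.card_pos.2 ⟨a, ha⟩
  exact_mod_cast Nat.sub_lt this one_pos

/-- Interpolation in one coordinate does not change the integral. -/
theorem exists_normalization_step {d : ℕ} {n : Fin d → ℕ} {I : Fin d → Set ℝ}
    {τ : Fin d → Measure ℝ} {s : Fin d → ℝ → ℝ} [∀ i, IsFiniteMeasure (τ i)]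
    (H : ∀ i, SignedConvexOrder (n i) (I i) (τ i) (s i)) (i : Fin d) (hi : τ i ≠ 0)
    {f : (Fin d → ℝ) → ℝ} (hfm : Measurable f) (hf : BoxDivConvex d n I f)
    (hfi : Integrable f (Measure.pi τ)) :
    ∃ (A : Finset ℝ) (g : (Fin d → ℝ) → ℝ), #A = n i ∧ ↑A ⊆ I i ∧ Measurable g ∧
      BoxDivConvex d n I g ∧ Integrable g (Measure.pi τ) ∧
      ∫ x, g x * ∏ j, s j (x j) ∂Measure.pi τ = ∫ x, f x * ∏ j, s j (x j) ∂Measure.pi τ ∧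
      (∀ x, x i ∈ A → g x = 0) ∧
      ∀ x, f x = 0 → (∀ a, f (Function.update x i a) = 0) → g x = 0 := by
  cases d with
  | zero => exact i.elim0
  | succ d =>
  have hmp := measurePreserving_insertNth τ i
  have hme := measurableEmbedding_insertNth i
  have hfi' := (hmp.integrable_comp_emb hme).2 hfi
  have hgood := hfi'.prod_right_ae
  obtain ⟨-, hnodes⟩ := (H i).eq_zero_or.resolve_left hi
  -- Nodes must have integrable sections, or the interpolant would not be integrable; by Fubini
  -- almost every point qualifies.
  obtain ⟨B, hBS, hB⟩ := hnodes
    {a | a ∈ I i ∧ Integrable (fun y => f (i.insertNth (α := fun _ => ℝ) a y))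
      (Measure.pi fun j => τ (i.succAbove j))}
    (by filter_upwards [(H i).ae_mem, hgood] with a h1 h2 using ⟨h1, h2⟩)
  obtain ⟨A, hAB, hA⟩ := Finset.exists_subset_card_eq (show n i ≤ #B by omega)
  have hAI : ∀ a ∈ A, a ∈ I i := fun a ha => (hBS (hAB ha)).1
  have hAf : ∀ a ∈ A, Integrable (fun y => f (i.insertNth (α := fun _ => ℝ) a y))
      (Measure.pi fun j => τ (i.succAbove j)) := fun a ha => (hBS (hAB ha)).2
  set h : ℝ → (Fin (d + 1) → ℝ) → ℝ := fun a x =>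
    (Lagrange.basis A id a).eval (x i) * f (Function.update x i a) with hh
  have hdeg : ∀ a ∈ A, (Lagrange.basis A id a).degree < n i := fun a ha => hA ▸ degree_basis_lt ha
  have hsm : Measurable fun x : Fin (d + 1) → ℝ => ∏ j, s j (x j) :=
    Finset.measurable_prod _ fun j _ => (H j).measurable.comp (measurable_pi_apply j)
  have hs1 : ∀ x : Fin (d + 1) → ℝ, |∏ j, s j (x j)| = 1 := fun x => by
    simp [Finset.abs_prod, (H _).abs_eq_one]
  have hhm : ∀ a, Measurable (h a) := fun a =>
    ((Lagrange.basis A id a).continuous.measurable.comp (measurable_pi_apply i)).mul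
      (hfm.comp (measurable_update_left))
  have hhi : ∀ a ∈ A, Integrable (h a) (Measure.pi τ) := by
    intro a ha
    rw [← hmp.integrable_comp_emb hme]
    have e : h a ∘ (fun p : ℝ × (Fin d → ℝ) => i.insertNth (α := fun _ => ℝ) p.1 p.2) = fun p =>
        (Lagrange.basis A id a).eval p.1 * f (i.insertNth (α := fun _ => ℝ) a p.2) := by
      ext p
      simp [hh]
    rw [e]
    exact (integrable_eval (H i).integrable_pow (hdeg a ha)).mul_prod (hAf a ha)
  -- By Fubini the integral splits off the factor ∫ (basis polynomial) s_i dτ_i, which is zero.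
  have hhz : ∀ a ∈ A, ∫ x, h a x * ∏ j, s j (x j) ∂Measure.pi τ = 0 := by
    intro a ha
    rw [← hmp.integral_comp hme]
    have e : ∀ p : ℝ × (Fin d → ℝ), h a (i.insertNth (α := fun _ => ℝ) p.1 p.2) *
        ∏ j, s j (i.insertNth (α := fun _ => ℝ) p.1 p.2 j) =
        ((Lagrange.basis A id a).eval p.1 * s i p.1) *
          (f (i.insertNth (α := fun _ => ℝ) a p.2) *
            ∏ j, s (i.succAbove j) (p.2 j)) := by
      intro p
      rw [Fin.prod_univ_succAbove _ i]
      simp only [hh, Fin.insertNth_apply_same, Fin.insertNth_apply_succAbove,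
        Fin.update_insertNth]
      ring
    simp only [e]
    rw [integral_prod_mul (fun t => (Lagrange.basis A id a).eval t * s i t)
      (fun y : Fin d → ℝ => f (i.insertNth (α := fun _ => ℝ) a y) * ∏ j, s (i.succAbove j) (y j)),
      (H i).integral_eval_eq_zero (hdeg a ha), zero_mul]
  refine ⟨A, fun x => f x - ∑ a ∈ A, h a x, hA, fun a ha => hAI a ha, ?_, ?_, ?_, ?_, ?_, ?_⟩
  · exact hfm.sub (Finset.measurable_sum _ fun a _ => hhm a)
  · have : ∀ C ⊆ A, BoxDivConvex (d + 1) n I fun x => f x - ∑ a ∈ C, h a x := by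
      intro C
      induction C using Finset.induction_on with
      | empty => intro _; simpa using hf
      | insert a C haC ih =>
        intro hCA
        have h1 := (ih ((Finset.subset_insert _ _).trans hCA)).sub_pseudopolynomial
          (hdeg a (hCA (Finset.mem_insert_self _ _)))
          (h := fun x => f (Function.update x i a)) fun x b => by simp
        refine h1.congr fun x _ => ?_
        rw [Finset.sum_insert haC]
        simp only [hh]
        ring
    exact this A (Finset.Subset.refl _)
  · exact hfi.sub (integrable_finsetSum _ hhi)
  · simp only [sub_mul, Finset.sum_mul]
    rw [integral_sub (hfi.mul_of_abs_eq_one hsm hs1)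
      (integrable_finsetSum _ fun a ha => (hhi a ha).mul_of_abs_eq_one hsm hs1),
      integral_finsetSum _ fun a ha => (hhi a ha).mul_of_abs_eq_one hsm hs1,
      Finset.sum_eq_zero hhz, sub_zero]
  · intro x hx
    have h1 : ∑ a ∈ A, h a x = (interp A fun a => f (Function.update x i a)).eval (x i) :=
      (eval_interp_eq_sum A _ _).symm
    dsimp only
    rw [h1, eval_interp_of_mem hx, Function.update_eq_self, sub_self]
  · intro x hx hxa
    simp [hh, hx, hxa]

/-- Interpolation in all coordinates. -/
theorem exists_normalization {d : ℕ} {n : Fin d → ℕ} {I : Fin d → Set ℝ}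
    {τ : Fin d → Measure ℝ} {s : Fin d → ℝ → ℝ} [∀ i, IsFiniteMeasure (τ i)]
    (H : ∀ i, SignedConvexOrder (n i) (I i) (τ i) (s i)) (hτ : ∀ i, τ i ≠ 0)
    {f : (Fin d → ℝ) → ℝ} (hfm : Measurable f) (hf : BoxDivConvex d n I f)
    (hfi : Integrable f (Measure.pi τ)) :
    ∃ (A : Fin d → Finset ℝ) (g : (Fin d → ℝ) → ℝ), (∀ i, #(A i) = n i) ∧ (∀ i, ↑(A i) ⊆ I i) ∧
      Measurable g ∧ BoxDivConvex d n I g ∧ Integrable g (Measure.pi τ) ∧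
      ∫ x, g x * ∏ j, s j (x j) ∂Measure.pi τ = ∫ x, f x * ∏ j, s j (x j) ∂Measure.pi τ ∧
      ∀ x, (∃ i, x i ∈ A i) → g x = 0 := by
  suffices ∀ W : Finset (Fin d), ∃ (A : Fin d → Finset ℝ) (g : (Fin d → ℝ) → ℝ),
      (∀ i ∈ W, #(A i) = n i) ∧ (∀ i ∈ W, ↑(A i) ⊆ I i) ∧
      Measurable g ∧ BoxDivConvex d n I g ∧ Integrable g (Measure.pi τ) ∧
      ∫ x, g x * ∏ j, s j (x j) ∂Measure.pi τ = ∫ x, f x * ∏ j, s j (x j) ∂Measure.pi τ ∧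
      ∀ x, (∃ i ∈ W, x i ∈ A i) → g x = 0 by
    obtain ⟨A, g, h1, h2, h3, h4, h5, h6, h7⟩ := this univ
    exact ⟨A, g, fun i => h1 i (Finset.mem_univ i), fun i => h2 i (Finset.mem_univ i), h3, h4, h5,
      h6, fun x ⟨i, hi⟩ => h7 x ⟨i, Finset.mem_univ i, hi⟩⟩
  intro W
  induction W using Finset.induction_on with
  | empty => exact ⟨fun _ => ∅, f, by simp, by simp, hfm, hf, hfi, rfl, by simp⟩
  | insert k W hk ih =>
    obtain ⟨A, g, h1, h2, h3, h4, h5, h6, h7⟩ := ih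
    obtain ⟨B, g', k1, k2, k3, k4, k5, k6, k7, k8⟩ :=
      exists_normalization_step H k (hτ k) h3 h4 h5
    have hne : ∀ i ∈ W, i ≠ k := fun i hi h => hk (h ▸ hi)
    refine ⟨Function.update A k B, g', ?_, ?_, k3, k4, k5, k6.trans h6, ?_⟩
    · intro i hi
      rcases Finset.mem_insert.1 hi with rfl | hi
      · rwa [Function.update_self]
      · rw [Function.update_of_ne (hne i hi)]
        exact h1 i hi
    · intro i hi
      rcases Finset.mem_insert.1 hi with rfl | hi
      · rwa [Function.update_self]
      · rw [Function.update_of_ne (hne i hi)]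
        exact h2 i hi
    · rintro x ⟨i, hi, hx⟩
      rcases Finset.mem_insert.1 hi with rfl | hi
      · rw [Function.update_self] at hx
        exact k7 x hx
      · rw [Function.update_of_ne (hne i hi)] at hx
        -- Changing coordinate k leaves x_i a node, so zeros gained earlier survive.
        refine k8 x (h7 x ⟨i, hi, hx⟩) fun a => h7 _ ⟨i, hi, ?_⟩
        rwa [Function.update_of_ne (hne i hi)]

/-! ### Integrable sections and induction on the dimension -/

theorem ae_mem_box {d : ℕ} {τ : Fin d → Measure ℝ} [∀ i, IsFiniteMeasure (τ i)]
    {I : Fin d → Set ℝ} (h : ∀ i, ∀ᵐ x ∂τ i, x ∈ I i) :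
    ∀ᵐ x ∂Measure.pi τ, ∀ i, x i ∈ I i :=
  eventually_all.2 fun i => Measure.tendsto_eval_ae_ae.eventually (h i)

/-- The set of integrable sections of a normalized box-convex function is an interval. -/
theorem integrable_section_of_between {d : ℕ} {n : Fin (d + 1) → ℕ} {I : Fin (d + 1) → Set ℝ}
    {ρ : Measure (Fin d → ℝ)} (hρ : ∀ᵐ y ∂ρ, ∀ i, y i ∈ I (Fin.castSucc i))
    {f : (Fin (d + 1) → ℝ) → ℝ} (hfm : Measurable f) (hf : BoxDivConvex (d + 1) n I f)
    {A : Fin (d + 1) → Finset ℝ} (hA : ∀ i, #(A i) = n i) (hAI : ∀ i, ↑(A i) ⊆ I i)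
    (hfA : ∀ x, (∃ i, x i ∈ A i) → f x = 0) {U : Finset ℝ} (hU : #U = n (Fin.last d) + 1)
    (hUI : ↑U ⊆ I (Fin.last d)) (hUi : ∀ u ∈ U, Integrable (fun y => f (snocR y u)) ρ)
    {a b t : ℝ} (ha : a ∈ U) (hb : b ∈ U) (hat : a < t) (htb : t < b) (ht : t ∈ I (Fin.last d)) :
    Integrable (fun y => f (snocR y t)) ρ := by
  have hL : ∀ V ⊆ U, Integrable (fun y => (interp V fun u => f (snocR y u)).eval t) ρ := by
    intro V hV
    simp only [eval_interp_eq_sum]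
    exact integrable_finsetSum _ fun u hu => (hUi u (hV hu)).const_mul _
  refine ((hL _ (Finset.erase_subset a U)).abs.add (hL _ (Finset.erase_subset b U)).abs).mono'
    (hfm.comp ?_).aestronglyMeasurable ?_
  · exact measurable_pi_iff.2 fun i => by
      refine Fin.lastCases ?_ (fun i => ?_) i
      · simp [snocR]
      · simpa [snocR] using measurable_pi_apply i
  filter_upwards [hρ] with y hy
  rw [Real.norm_eq_abs, Pi.add_apply]
  -- The sign of w makes w f(y, ·) n-convex, by `mul_prod_nonneg` applied to divided differences in
  -- the last variable. If w = 0, some y_i is a node and f vanishes.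
  set w := ∏ i : Fin d, ∏ c ∈ A i.castSucc, (y i - c) with hw
  by_cases hw0 : w = 0
  · have : f (snocR y t) = 0 := by
      obtain ⟨i, -, hi⟩ := Finset.prod_eq_zero_iff.1 hw0
      obtain ⟨c, hc, hyc⟩ := Finset.prod_eq_zero_iff.1 hi
      refine hfA _ ⟨i.castSucc, ?_⟩
      rw [snocR, Fin.snoc_castSucc, sub_eq_zero.1 hyc]
      exact hc
    rw [this, abs_zero]
    positivity
  have hconv : NConvexOn (n (Fin.last d)) (I (Fin.last d)) fun u => w * f (snocR y u) := by
    intro T hT hTc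
    rw [divDiff_const_mul, mul_comm]
    refine (hf T hT hTc).mul_prod_nonneg (A := fun i => A i.castSucc) (fun i => hA _)
      (fun i => hAI _) ?_ y hy
    rintro z ⟨i, hi⟩
    rw [divDiff_congr (g := fun _ => 0 * 0) fun t _ => ?_, divDiff_const_mul, zero_mul]
    rw [mul_zero]
    exact hfA _ ⟨i.castSucc, by simpa using hi⟩
  have hs := hconv.interp_sandwich hU hUI ha hb hat htb ht
  have hlin : ∀ V : Finset ℝ, (interp V fun u => w * f (snocR y u)).eval t =
      w * (interp V fun u => f (snocR y u)).eval t := by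
    intro V
    rw [eval_interp_eq_sum, eval_interp_eq_sum, Finset.mul_sum]
    exact Finset.sum_congr rfl fun u _ => by ring
  -- The sandwich inequality is quadratic, so it carries the factor w² > 0 and the sign of w drops
  -- out.
  rw [hlin, hlin, ← mul_sub, ← mul_sub, mul_mul_mul_comm] at hs
  have hs' := nonneg_of_mul_nonneg_right hs (mul_self_pos.2 hw0)
  have := abs_sub_le_of_between (z := 0) hs'
  simpa using this

/-- Fubini reduces the integral to the one-variable inequality for the partial integral over the
first d coordinates, on the interval S of integrable sections. -/
theorem integral_nonneg_of_normalized {d : ℕ} {n : Fin d → ℕ} {I : Fin d → Set ℝ}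
    (hI : ∀ i, (I i).OrdConnected) {τ : Fin d → Measure ℝ} {s : Fin d → ℝ → ℝ}
    [∀ i, IsFiniteMeasure (τ i)] (H : ∀ i, SignedConvexOrder (n i) (I i) (τ i) (s i))
    {A : Fin d → Finset ℝ} (hA : ∀ i, #(A i) = n i) (hAI : ∀ i, ↑(A i) ⊆ I i)
    {f : (Fin d → ℝ) → ℝ} (hfm : Measurable f) (hf : BoxDivConvex d n I f)
    (hfi : Integrable f (Measure.pi τ)) (hfA : ∀ x, (∃ i, x i ∈ A i) → f x = 0) :
    0 ≤ ∫ x, f x * ∏ i, s i (x i) ∂Measure.pi τ := by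
  induction d with
  | zero =>
    have h : 0 ≤ f Fin.elim0 := hf
    refine integral_nonneg fun x => ?_
    rw [Subsingleton.elim x Fin.elim0]
    simpa using h
  | succ d ih =>
    have hmp := measurePreserving_insertNth τ (Fin.last d)
    have hme := measurableEmbedding_insertNth (Fin.last d)
    simp only [Fin.insertNth_last', Fin.succAbove_last] at hmp hme
    set τ' : Fin d → Measure ℝ := fun i => τ i.castSucc with hτ'
    have hfi' := (hmp.integrable_comp_emb hme).2 hfi
    have hsm : Measurable fun y : Fin d → ℝ => ∏ i, s i.castSucc (y i) :=
      Finset.measurable_prod _ fun i _ => (H _).measurable.comp (measurable_pi_apply i)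
    have hs1 : ∀ y : Fin d → ℝ, |∏ i, s i.castSucc (y i)| = 1 := fun y => by
      simp [Finset.abs_prod, (H _).abs_eq_one]
    rw [← hmp.integral_comp hme]
    have e : ∀ p : ℝ × (Fin d → ℝ), f (snocR p.2 p.1) * ∏ i, s i (snocR p.2 p.1 i) =
        f (snocR p.2 p.1) * (∏ i, s i.castSucc (p.2 i)) * s (Fin.last d) p.1 := fun p => by
      rw [Fin.prod_univ_castSucc]
      simp only [snocR, Fin.snoc_castSucc, Fin.snoc_last]
      ring
    have hint1 : Integrable (fun p : ℝ × (Fin d → ℝ) =>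
        f (snocR p.2 p.1) * ∏ i, s i.castSucc (p.2 i))
        ((τ (Fin.last d)).prod (Measure.pi τ')) :=
      Integrable.mul_of_abs_eq_one hfi' (hsm.comp measurable_snd) fun p => hs1 p.2
    have hint2 : Integrable (fun p : ℝ × (Fin d → ℝ) =>
        f (snocR p.2 p.1) * (∏ i, s i.castSucc (p.2 i)) * s (Fin.last d) p.1)
        ((τ (Fin.last d)).prod (Measure.pi τ')) :=
      hint1.mul_of_abs_eq_one ((H _).measurable.comp measurable_fst) fun p => (H _).abs_eq_one _
    simp only [e]
    rw [integral_prod _ hint2]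
    simp only [integral_mul_const]
    rcases (H (Fin.last d)).eq_zero_or with h0 | ⟨hn, hnodes⟩
    · simp [h0]
    set S : Set ℝ := {t | t ∈ I (Fin.last d) ∧
      Integrable (fun y => f (snocR y t)) (Measure.pi τ')} with hS
    have hSae : ∀ᵐ t ∂τ (Fin.last d), t ∈ S := by
      filter_upwards [(H (Fin.last d)).ae_mem, hfi'.prod_right_ae] with t h1 h2 using ⟨h1, h2⟩
    have hSord : S.OrdConnected := by
      refine ⟨fun a ha b hb t ht => ?_⟩
      rcases ht.1.eq_or_lt with rfl | hat
      · exact ha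
      rcases ht.2.eq_or_lt with rfl | htb
      · exact hb
      have htI : t ∈ I (Fin.last d) := (hI _).out ha.1 hb.1 ht
      obtain ⟨U0, hU0S, hU0⟩ := hnodes S hSae
      have hab : a ≠ b := (hat.trans htb).ne
      -- The sandwich needs n + 1 nodes in S, among them a and b on either side of t.
      obtain ⟨U, h1, h2, h3⟩ := Finset.exists_subsuperset_card_eq
        (s := {a, b}) (t := {a, b} ∪ U0) (n := n (Fin.last d) + 1) Finset.subset_union_left
        (by rw [Finset.card_pair hab]; omega)
        (hU0 ▸ Finset.card_le_card Finset.subset_union_right)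
      have hUS : ∀ u ∈ U, u ∈ S := fun u hu => by
        rcases Finset.mem_union.1 (h2 hu) with h | h
        · rcases Finset.mem_insert.1 h with rfl | h
          · exact ha
          · rw [Finset.mem_singleton.1 h]
            exact hb
        · exact hU0S h
      exact ⟨htI, integrable_section_of_between (ae_mem_box fun i => (H i.castSucc).ae_mem) hfm hf
        hA hAI hfA h3 (fun u hu => (hUS u hu).1) (fun u hu => (hUS u hu).2) (h1 (by simp))
        (h1 (by simp)) hat htb htI⟩
    refine (H (Fin.last d)).integral_nonneg S hSord hSae _ ?_ hint1.integral_prod_left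
    intro T hTS hTc
    have hTi : ∀ t ∈ T, Integrable (fun y => f (snocR y t)) (Measure.pi τ') := fun t ht =>
      (hTS ht).2
    have hTf : ∀ t, Measurable fun y : Fin d → ℝ => f (snocR y t) := fun t => by
      refine hfm.comp (measurable_pi_iff.2 fun i => ?_)
      refine Fin.lastCases ?_ (fun i => ?_) i
      · simp [snocR]
      · simpa [snocR] using measurable_pi_apply i
    have h1 := ih (n := fun i => n i.castSucc) (I := fun i => I i.castSucc) (fun i => hI _)
      (τ := τ') (s := fun i => s i.castSucc) (fun i => H _) (A := fun i => A i.castSucc)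
      (fun i => hA _) (fun i => hAI _) (f := fun y => divDiff T fun t => f (snocR y t))
      (Finset.measurable_sum _ fun t _ => (hTf t).div_const _)
      (hf T (fun t ht => (hTS ht).1) hTc)
      (integrable_finsetSum _ fun t ht => (hTi t ht).div_const _) (by
        rintro z ⟨i, hi⟩
        rw [divDiff_congr (g := fun _ => 0 * 0) fun t _ => ?_, divDiff_const_mul, zero_mul]
        rw [mul_zero]
        exact hfA _ ⟨i.castSucc, by simpa using hi⟩)
    -- At nodes in S the divided difference commutes with the integral, being a finite sum of
    -- integrable sections.
    refine h1.trans_eq ?_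
    simp only [← divDiff_mul_const]
    unfold divDiff
    rw [integral_finsetSum _ fun t ht =>
      ((hTi t ht).mul_of_abs_eq_one hsm hs1).div_const _]
    exact Finset.sum_congr rfl fun t _ => integral_div _ _

theorem integral_nonneg_of_boxDivConvex {d : ℕ} {n : Fin d → ℕ} {I : Fin d → Set ℝ}
    (hI : ∀ i, (I i).OrdConnected) {τ : Fin d → Measure ℝ} {s : Fin d → ℝ → ℝ}
    [∀ i, IsFiniteMeasure (τ i)] (H : ∀ i, SignedConvexOrder (n i) (I i) (τ i) (s i))
    {f : (Fin d → ℝ) → ℝ} (hfm : Measurable f) (hf : BoxDivConvex d n I f)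
    (hfi : Integrable f (Measure.pi τ)) :
    0 ≤ ∫ x, f x * ∏ i, s i (x i) ∂Measure.pi τ := by
  by_cases hτ : ∀ i, τ i ≠ 0
  · obtain ⟨A, g, hA, hAI, hgm, hg, hgi, hfg, hgA⟩ := exists_normalization H hτ hfm hf hfi
    rw [← hfg]
    exact integral_nonneg_of_normalized hI H hA hAI hgm hg hgi hgA
  · push Not at hτ
    obtain ⟨i, hi⟩ := hτ
    have : Measure.pi τ = 0 := by
      rw [← Measure.measure_univ_eq_zero, Measure.pi_univ]
      exact Finset.prod_eq_zero (Finset.mem_univ i) (by simp [hi])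
    simp [this]

end

end

/-! ### The theorem for random variables -/

theorem mainTheorem10 {d : ℕ} (n : Fin d → ℕ) (I : Fin d → Set ℝ)
    (hI : ∀ i, (I i).OrdConnected)
    {ΩX ΩY : Fin d → Type*} [∀ i, MeasurableSpace (ΩX i)] [∀ i, MeasurableSpace (ΩY i)]
    (PX : (i : Fin d) → Measure (ΩX i)) (PY : (i : Fin d) → Measure (ΩY i))
    [∀ i, IsProbabilityMeasure (PX i)] [∀ i, IsProbabilityMeasure (PY i)]
    (X : (i : Fin d) → ΩX i → ℝ) (Y : (i : Fin d) → ΩY i → ℝ)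
    (hX : ∀ i, Measurable (X i)) (hY : ∀ i, Measurable (Y i))
    (hXI : ∀ i ω, X i ω ∈ I i) (hYI : ∀ i ω, Y i ω ∈ I i)
    (hXmom : ∀ i, 1 ≤ n i → Integrable (fun ω => |X i ω| ^ (n i - 1)) (PX i))
    (hYmom : ∀ i, 1 ≤ n i → Integrable (fun ω => |Y i ω| ^ (n i - 1)) (PY i))
    (hXY : ∀ i, PredConvexOrder (n i) (I i) ((PX i).map (X i)) ((PY i).map (Y i)))
    {ΩZ : Finset (Fin d) → Type*} [∀ A, MeasurableSpace (ΩZ A)]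
    (PZ : (A : Finset (Fin d)) → Measure (ΩZ A)) [∀ A, IsProbabilityMeasure (PZ A)]
    (Z : (A : Finset (Fin d)) → Fin d → ΩZ A → ℝ)
    (hZindep : ∀ A, iIndepFun (Z A) (PZ A))
    (hZX : ∀ A, ∀ i ∈ A, IdentDistrib (Z A i) (X i) (PZ A) (PX i))
    (hZY : ∀ A, ∀ i ∉ A, IdentDistrib (Z A i) (Y i) (PZ A) (PY i))
    (f : (Fin d → ℝ) → ℝ) (hfc : ContinuousOn f (Set.univ.pi I)) (hf : BoxConvexOn n I f) :
    ((∀ A, Integrable (fun ω => f fun i => Z A i ω) (PZ A)) →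
      0 ≤ ∑ A : Finset (Fin d), (-1 : ℝ) ^ A.card * ∫ ω, f (fun i => Z A i ω) ∂(PZ A)) ∧
    ((prodSignedDiff (fun i => (PY i).map (Y i)) (fun i => (PX i).map (X i))).Integrable f →
      0 ≤ ∫ᵛ x, f x ∂•(prodSignedDiff (fun i => (PY i).map (Y i))
        (fun i => (PX i).map (X i)))) := by
  classical
  have hIm : ∀ i, MeasurableSet (I i) := fun i => (hI i).measurableSet
  have hbox : MeasurableSet (Set.univ.pi I) := MeasurableSet.univ_pi hIm
  have hμ : ∀ i, IsProbabilityMeasure ((PY i).map (Y i)) := fun i =>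
    Measure.isProbabilityMeasure_map (hY i).aemeasurable
  have hν : ∀ i, IsProbabilityMeasure ((PX i).map (X i)) := fun i =>
    Measure.isProbabilityMeasure_map (hX i).aemeasurable
  have hμI : ∀ i, ∀ᵐ x ∂(PY i).map (Y i), x ∈ I i := fun i =>
    (ae_map_iff (hY i).aemeasurable (hIm i)).2 (ae_of_all _ (hYI i))
  have hνI : ∀ i, ∀ᵐ x ∂(PX i).map (X i), x ∈ I i := fun i =>
    (ae_map_iff (hX i).aemeasurable (hIm i)).2 (ae_of_all _ (hXI i))
  have hex := fun i => exists_signedConvexOrder (hμI i) (hνI i)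
    (fun hn => (integrable_map_measure (by fun_prop) (hY i).aemeasurable).2 (hYmom i hn))
    (fun hn => (integrable_map_measure (by fun_prop) (hX i).aemeasurable).2 (hXmom i hn)) (hXY i)
  choose τ s hτ H hset using hex
  have hsm := fun i => (H i).measurable
  have hs1 := fun i => (H i).abs_eq_one
  have hvar := variation_prodSignedDiff hsm hs1 hset
  -- Continuity of f is known only on the box; the cut-off g is measurable everywhere and agrees
  -- with f almost everywhere for all measures involved.
  set g : (Fin d → ℝ) → ℝ := (Set.univ.pi I).indicator f with hg
  have hgm : Measurable g := by
    have h1 : Measurable ((Set.univ.pi I).piecewise f 0) :=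
      hfc.measurable_piecewise continuousOn_const hbox
    rwa [Set.piecewise_eq_indicator] at h1
  have hgf : ∀ x, (∀ i, x i ∈ I i) → f x = g x := fun x hx =>
    (Set.indicator_of_mem (show x ∈ Set.univ.pi I from fun i _ => hx i) f).symm
  have hgc : BoxDivConvex d n I g := hf.boxDivConvex.congr hgf
  have main : (prodSignedDiff (fun i => (PY i).map (Y i)) (fun i => (PX i).map (X i))).Integrable f →
      0 ≤ ∫ᵛ x, f x ∂•(prodSignedDiff (fun i => (PY i).map (Y i))
        (fun i => (PX i).map (X i))) := by
    intro hfi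
    rw [VectorMeasure.Integrable, hvar] at hfi
    rw [integral_prodSignedDiff hsm hs1 hset hfi]
    have hae : f =ᵐ[Measure.pi τ] g := (ae_mem_box fun i => (H i).ae_mem).mono hgf
    have h1 := integral_nonneg_of_boxDivConvex hI H hgm hgc (hfi.congr hae)
    refine h1.trans_eq (integral_congr_ae ?_)
    filter_upwards [hae] with x hx
    rw [hx]
  refine ⟨fun hZ => ?_, main⟩
  have hZm : ∀ A i, AEMeasurable (Z A i) (PZ A) := fun A i => by
    by_cases hi : i ∈ A
    · exact (hZX A i hi).aemeasurable_fst
    · exact (hZY A i hi).aemeasurable_fst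
  have hmap : ∀ A, (PZ A).map (fun ω i => Z A i ω) =
      Measure.pi (mixMeasure A (fun i => (PY i).map (Y i)) fun i => (PX i).map (X i)) := by
    intro A
    rw [(iIndepFun_iff_map_fun_eq_pi_map (hZm A)).1 (hZindep A)]
    congr 1
    ext1 i
    unfold mixMeasure
    split_ifs with hi
    · exact (hZX A i hi).map_eq
    · exact (hZY A i hi).map_eq
  have hmixI : ∀ A i, ∀ᵐ x ∂mixMeasure A (fun i => (PY i).map (Y i))
      (fun i => (PX i).map (X i)) i, x ∈ I i := by
    intro A i
    unfold mixMeasure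
    split_ifs
    · exact hνI i
    · exact hμI i
  have hmeas : ∀ A, AEStronglyMeasurable f ((PZ A).map (fun ω i => Z A i ω)) := by
    intro A
    rw [hmap]
    refine hgm.aestronglyMeasurable.congr ?_
    exact (ae_mem_box (hmixI A)).mono fun x hx => (hgf x hx).symm
  have hZm' : ∀ A, AEMeasurable (fun ω i => Z A i ω) (PZ A) := fun A =>
    aemeasurable_pi_lambda _ fun i => hZm A i
  have hfA : ∀ A, Integrable f
      (Measure.pi (mixMeasure A (fun i => (PY i).map (Y i)) fun i => (PX i).map (X i))) := by
    intro A
    rw [← hmap, integrable_map_measure (hmeas A) (hZm' A)]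
    exact hZ A
  obtain ⟨h1, h2⟩ := integrable_prodSignedDiff_of_forall hfA
  refine (main h1).trans_eq (h2.trans (Finset.sum_congr rfl fun A _ => ?_))
  rw [← hmap, integral_map (hZm' A) (hmeas A)]
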